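/- Let $P\subset\mathbb{R}^2$ be a convex lattice polygon, that is, the convex hull of a nonempty finite set of points of $\mathbb{Z}^2$, and let $g$ be the number of points of $\mathbb{Z}^2$ lying in the topological interior of $P$. Define the lattice width of $P$ as $$\mathrm{lw}(P)=\min_{T}\Bigl(\max_{x\in P}T_{\mathbb{R}}(x)-\min_{x\in P}T_{\mathbb{R}}(x)\Bigr),$$ where $T$ runs over all nonzero linear maps $\mathbb{Z}^2\to\mathbb{Z}$ and $T_{\mathbb{R}}:\mathbb{R}^2\to\mathbb{R}$ is the real-linear extension of $T$. If $7\le g\le 12$ and $g\ne 10$, then $$\mathrm{lw}(P)\le\left\lceil\frac{g}{2}\right\rceil.$$ -/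

import Mathlib

namespace LatticePolygon

/-- The inclusion of the lattice `ℤ²` into the plane `ℝ²`. -/
def toPlane (p : ℤ × ℤ) : ℝ × ℝ := ((p.1 : ℝ), (p.2 : ℝ))

/-- A convex lattice polygon: the convex hull in `ℝ²` of a nonempty finite set of points with
integer coordinates. Segments and points are allowed as degenerate polygons; they have no
interior points. -/
def IsConvexLatticePolygon (P : Set (ℝ × ℝ)) : Prop :=
  ∃ V : Finset (ℤ × ℤ), V.Nonempty ∧ P = convexHull ℝ (toPlane '' (V : Set (ℤ × ℤ)))

/-- The lattice points contained in the (topological) interior of `P`. -/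
def interiorLatticePoints (P : Set (ℝ × ℝ)) : Set (ℤ × ℤ) :=
  {p | toPlane p ∈ interior P}

/-- The real-linear extension `ℝ² → ℝ` of a linear map `T : ℤ² → ℤ`. -/
def realExtension (T : (ℤ × ℤ) →ₗ[ℤ] ℤ) (x : ℝ × ℝ) : ℝ :=
  (T (1, 0) : ℝ) * x.1 + (T (0, 1) : ℝ) * x.2

/-- The width of `P` along `T`: the length of the image of `P` in `ℝ` under `T`
(the image is a nonempty compact interval when `P` is a convex lattice polygon). -/
noncomputable def widthAlong (P : Set (ℝ × ℝ)) (T : (ℤ × ℤ) →ₗ[ℤ] ℤ) : ℝ :=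
  sSup (realExtension T '' P) - sInf (realExtension T '' P)

/-- The lattice width of `P`: the minimal width of the image of `P` under a nonzero linear map
`ℤ² → ℤ`. For a convex lattice polygon all these widths are nonnegative integers, so the infimum
is a minimum. -/
noncomputable def latticeWidth (P : Set (ℝ × ℝ)) : ℝ :=
  sInf {w : ℝ | ∃ T : (ℤ × ℤ) →ₗ[ℤ] ℤ, T ≠ 0 ∧ w = widthAlong P T}

end LatticePolygon

/-!
Let `P` be a lattice polygon with `g` interior lattice points and suppose that every lattice width
of `P` exceeds `⌈g / 2⌉`. After a unimodular change of coordinates the minimal width `w` is attained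
by the second coordinate (`exists_slab`), so that `P` lies in the strip `0 ≤ y ≤ w`, touches both
of its sides, and has width at least `w` along every nonzero integral functional (`Slab`).

Every row `0 < y < w` contains an interior lattice point (`Slab.exists_mem_row`). Indeed, if the row
`y = j` contains none, then `P` lies between two lines through adjacent lattice points of that row.
Comparing the widths along `x - t y` for the integers `t` next to the slopes of these lines shows
that `P` is a unimodular image of the triangle with vertices `(0, 0)`, `(w, 0)`, `(0, w)`. This
triangle has `(w - 1) (w - 2) / 2` interior lattice points, which for `w ≥ 5` is `6`, `10` or at
least `15`.

Hence the `g` interior lattice points are distributed over `w - 1 ≥ g / 2` nonempty rows, and by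
convexity they form an interval in each row. If a point of the polygon and an interior lattice point
span a segment that crosses an intermediate row, then the lattice points in that row between the
segment and the known interior points are interior too (`mem_intPts_of_between`). This bounds each
row in terms of any two others, and bounds the whole polygon in terms of its interior lattice points
(`Side`, `Profile`). After a shear only finitely many distributions remain. They are
enumerated row by row by `search`, which finds in each case that the bounds contradict each other or
that the polygon has width less than `w` along one of `x`, `x + y`, `x - y`, `x - 2 y`. The kernel
evaluates this search (`start_eq_true`), and `Profile.search_eq_false` is its soundness.
-/

namespace LatticePolygon

/-! ### A search over row profiles, in a form the kernel evaluates quickly -/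

/-- The value `k n`, written so that reduction evaluates `n` to a numeral before substituting it
into `k`; `d` is irrelevant. For the same reason the definitions below use `cond`, `Nat.add`,
`Nat.ble` and the like, which the kernel evaluates without unfolding instances. -/
def force {α : Type} (d : α) (n : ℕ) (k : ℕ → α) : α :=
  Nat.rec d (fun m _ => k m) (Nat.add n 1)

theorem force_eq {α : Type} (d : α) (n : ℕ) (k : ℕ → α) : force d n k = k n := rfl

/-- Whether `f i` holds for all `i < N`; the recursor supplies each `i` as a numeral. -/
def allBelow (N : ℕ) (f : ℕ → Bool) : Bool :=
  Nat.rec true (fun i ih => cond (f i) ih false) N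

theorem of_allBelow {N : ℕ} {f : ℕ → Bool} (h : allBelow N f = true) :
    ∀ i, i < N → f i = true := by
  induction N with
  | zero => intro i hi; omega
  | succ N ih =>
    have h' : cond (f N) (allBelow N f) false = true := h
    cases hf : f N with
    | false => simp [hf] at h'
    | true =>
      simp only [hf, cond_true] at h'
      intro i hi
      rcases Nat.lt_succ_iff_lt_or_eq.mp hi with h1 | rfl
      · exact ih h' i h1
      · exact hf

/-- The list `xs = [a₀, a₁, …]` records the abscissas of the leftmost interior lattice points of
consecutive rows, the first of which is at distance `p` from a given row. `Fits X p xs` says that the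
segment from the point with abscissa `X` in the given row to the point `aⱼ` passes strictly to the
right of `aᵢ - 1` for all `i < j`. -/
def Fits (X : ℤ) (p : ℕ) (xs : List ℕ) : Prop :=
  ∀ i j, i < j → ∀ (hi : i < xs.length) (hj : j < xs.length),
    ((p : ℤ) + j) * ((xs[i] : ℤ) - 1) < ((j : ℤ) - i) * X + ((p : ℤ) + i) * (xs[j] : ℤ)

/-- The constraints of `Fits v` between a point `x` at distance `p` and the points behind it, the
first of which is at distance `p + e`. -/
def fitsFar (v x p : ℕ) : List ℕ → ℕ → Bool
  | [], _ => true
  | z :: zs, e =>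
    cond (Nat.ble (Nat.add (Nat.mul (Nat.add p e) x) 1)
        (Nat.add (Nat.add (Nat.add p e) (Nat.mul p z)) (Nat.mul e v)))
      (fitsFar v x p zs (Nat.add e 1)) false

/-- A Boolean version of `Fits`. -/
def fits (v : ℕ) : List ℕ → ℕ → Bool
  | [], _ => true
  | x :: xs, p => cond (fitsFar v x p xs 1) (fits v xs (Nat.add p 1)) false

/-- Raises `v`, at most `n` times, until it fits. -/
def raise (xs : List ℕ) : ℕ → ℕ → ℕ
  | 0, v => v
  | n + 1, v => cond (fits v xs 1) v (force 0 (Nat.add v 1) (raise xs n))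

/-- A lower bound for the abscissas that fit a list of rows. The first two rows give the bound
`2 * x - 1 - y`, which is then raised. -/
def lowerBound : List ℕ → ℕ
  | x :: y :: xs => force 0 (Nat.sub (Nat.mul 2 x) (Nat.add y 1)) (raise (x :: y :: xs) 8)
  | _ => 0

theorem Fits.mono {X Y : ℤ} {p : ℕ} {xs : List ℕ} (h : Fits X p xs) (hXY : X ≤ Y) :
    Fits Y p xs := by
  intro i j hij hi hj
  have h1 := h i j hij hi hj
  have h2 : (0 : ℤ) < (j : ℤ) - i := by omega
  nlinarith

theorem Fits.tail {X : ℤ} {p x : ℕ} {xs : List ℕ} (h : Fits X p (x :: xs)) :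
    Fits X (p + 1) xs := by
  intro i j hij hi hj
  have h1 := h (i + 1) (j + 1) (by omega) (by simpa using hi) (by simpa using hj)
  simp only [List.getElem_cons_succ] at h1
  push_cast at h1 ⊢
  linarith

theorem Fits.take {X : ℤ} {p : ℕ} {xs : List ℕ} (h : Fits X p xs) (d : ℕ) :
    Fits X p (xs.take d) := by
  intro i j hij hi hj
  simp only [List.length_take, lt_inf_iff] at hi hj
  simpa using h i j hij hi.2 hj.2

theorem fitsFar_eq_true {v x p : ℕ} {zs : List ℕ} {e : ℕ} {X : ℤ} (hX : X ≤ v)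
    (h : ∀ i (hi : i < zs.length),
      ((p : ℤ) + e + i) * ((x : ℤ) - 1) < ((e : ℤ) + i) * X + p * (zs[i] : ℤ)) :
    fitsFar v x p zs e = true := by
  induction zs generalizing e with
  | nil => rfl
  | cons z zs ih =>
    have h0 := h 0 (by simp)
    simp only [Nat.cast_zero, add_zero, List.getElem_cons_zero] at h0
    have h1 : (p + e) * x + 1 ≤ (p + e) + p * z + e * v := by
      have : (e : ℤ) * X ≤ e * v := by gcongr
      zify
      linarith
    have h2 : Nat.ble (Nat.add (Nat.mul (Nat.add p e) x) 1)
        (Nat.add (Nat.add (Nat.add p e) (Nat.mul p z)) (Nat.mul e v)) = true :=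
      Nat.ble_eq.mpr h1
    rw [fitsFar, h2, cond_true]
    apply ih
    intro i hi
    have h3 := h (i + 1) (by simpa using hi)
    simp only [List.getElem_cons_succ] at h3
    have : ((Nat.add e 1 : ℕ) : ℤ) = e + 1 := by simp
    rw [this]
    push_cast at h3
    have e1 : (p : ℤ) + (e + 1) + i = p + e + (i + 1) := by ring
    have e2 : (e : ℤ) + 1 + i = e + (i + 1) := by ring
    rw [e1, e2]
    exact h3

theorem fits_eq_true {v p : ℕ} {xs : List ℕ} {X : ℤ} (hX : X ≤ v) (h : Fits X p xs) :
    fits v xs p = true := by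
  induction xs generalizing p with
  | nil => rfl
  | cons x xs ih =>
    have h1 : fitsFar v x p xs 1 = true := by
      apply fitsFar_eq_true hX
      intro i hi
      have := h 0 (i + 1) (by omega) (by simp) (by simpa using hi)
      simp only [List.getElem_cons_zero, List.getElem_cons_succ] at this
      push_cast at this ⊢
      linarith
    rw [fits, h1, cond_true]
    exact ih h.tail

theorem raise_le {xs : List ℕ} {X : ℕ} (h : Fits X 1 xs) (n v : ℕ) (hv : v ≤ X) :
    raise xs n v ≤ X := by
  induction n generalizing v with
  | zero => exact hv
  | succ n ih =>
    rw [raise, force_eq]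
    cases hf : fits v xs 1 with
    | true => simpa using hv
    | false =>
      rw [cond_false]
      apply ih
      by_contra hlt
      have hle : X ≤ v := by
        have : ¬ (v + 1 ≤ X) := hlt
        omega
      rw [fits_eq_true (by exact_mod_cast hle) h] at hf
      exact absurd hf (by simp)

theorem lowerBound_le_toNat {xs : List ℕ} {X : ℤ} (h : Fits X 1 xs) :
    lowerBound xs ≤ X.toNat := by
  match xs with
  | [] => simp [lowerBound]
  | [x] => simp [lowerBound]
  | x :: y :: xs =>
    rw [lowerBound, force_eq]
    apply raise_le (h.mono (Int.self_le_toNat X))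
    have := h 0 1 (by omega) (by simp) (by simp)
    simp only [List.getElem_cons_zero, List.getElem_cons_succ] at this
    push_cast at this
    have h2 : Nat.sub (Nat.mul 2 x) (Nat.add y 1) = 2 * x - (y + 1) := rfl
    rw [h2]
    omega

/-- A positive lower bound is not affected by truncation. -/
theorem lowerBound_le {xs : List ℕ} {X : ℤ} (h : Fits X 1 xs) (h1 : 1 ≤ lowerBound xs) :
    (lowerBound xs : ℤ) ≤ X := by
  have := lowerBound_le_toNat h
  omega

/-- The minimum of `aᵢ + t * i` over the entries `aᵢ` of a list, or the arbitrary value `1000` if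
that is smaller. -/
def slantMin (t : ℕ) : List ℕ → ℕ
  | [] => 1000
  | x :: xs => force 0 (Nat.add (slantMin t xs) t) fun y => cond (Nat.ble x y) x y

theorem slantMin_le (t : ℕ) (xs : List ℕ) (i : ℕ) (hi : i < xs.length) :
    slantMin t xs ≤ xs[i] + t * i := by
  induction xs generalizing i with
  | nil => simp at hi
  | cons x xs ih =>
    have h1 : slantMin t (x :: xs) = min x (slantMin t xs + t) := by
      rw [slantMin, force_eq]
      have : Nat.add (slantMin t xs) t = slantMin t xs + t := rfl
      rw [this]
      cases hb : Nat.ble x (slantMin t xs + t) with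
      | true => rw [cond_true, min_eq_left (Nat.ble_eq.mp hb)]
      | false =>
        rw [cond_false, min_eq_right]
        by_contra hlt
        rw [Nat.ble_eq.mpr (by omega)] at hb
        exact absurd hb (by simp)
    rw [h1]
    cases i with
    | zero => simp
    | succ i =>
      have := ih i (by simpa using hi)
      simp only [List.getElem_cons_succ]
      have h2 : t * (i + 1) = t * i + t := by ring
      omega

/-- Whether the lower bounds `us` and `vs` (each increased by one), for an abscissa and for its
reflection in `C / 2`, row by row from row `0` to row `w`, force a width less than `w` along a
functional of slope `± t`. -/
def narrowAlong (C w t : ℕ) (us vs : List ℕ) : Bool :=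
  Nat.blt (Nat.add (Nat.add C 2) (Nat.mul t w))
    (Nat.add w (Nat.add (slantMin t us) (slantMin t vs.reverse)))

/-- Whether one of four functionals has width less than `w`. -/
def narrow (C w : ℕ) (cl cs : List ℕ) : Bool :=
  narrowAlong C w 0 cl cs || narrowAlong C w 1 cs cl || narrowAlong C w 1 cl cs ||
    narrowAlong C w 2 cs cl

theorem lt_of_narrowAlong {C w t : ℕ} {us vs : List ℕ} (h : narrowAlong C w t us vs = true)
    (hv : vs.length = w + 1) {i j : ℕ} (hi : i < us.length) (hj : j < vs.length) :
    (C : ℤ) + 2 + t * w < w + us[i] + t * i + vs[j] + t * (w - j) := by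
  have h1 : C + 2 + t * w < w + (slantMin t us + slantMin t vs.reverse) := by
    simpa [narrowAlong, Nat.blt] using h
  have h2 := slantMin_le t us i hi
  have h3 := slantMin_le t vs.reverse (w - j) (by simp; omega)
  rw [List.getElem_reverse] at h3
  have h4 : vs.length - 1 - (w - j) = j := by omega
  simp only [h4] at h3
  have h5 : ((w - j : ℕ) : ℤ) = (w : ℤ) - j := by
    push_cast [show j ≤ w by omega]; ring
  zify at h1 h2 h3
  rw [h5] at h3
  linarith

/-- The larger of two numbers. -/
def maxNat (a b : ℕ) : ℕ :=
  force 0 a fun a => force 0 b fun b => cond (Nat.ble a b) b a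

theorem maxNat_eq (a b : ℕ) : maxNat a b = max a b := by
  rw [maxNat, force_eq, force_eq]
  cases hb : Nat.ble a b with
  | true => rw [cond_true, max_eq_right (Nat.ble_eq.mp hb)]
  | false =>
    rw [cond_false, max_eq_left]
    by_contra hlt
    rw [Nat.ble_eq.mpr (by omega)] at hb
    exact absurd hb (by simp)

/-- For each row of `above`, one plus a lower bound for the abscissas of the points of the polygon
in that row; `below` lists the rows below `above`, from top to bottom. -/
def refined : List ℕ → List ℕ → List ℕ
  | _, [] => []
  | below, x :: above =>
    cond (Nat.ble 1 x) (maxNat x (Nat.add (maxNat (lowerBound below) (lowerBound above)) 1)) x ::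
      refined (x :: below) above

/-- Whether a complete profile is impossible, using the nearest `d` rows to bound the polygon in
rows `0` and `w`, and the lists `cl` and `cs` in the other rows. -/
def leafTest (C w d : ℕ) (cl cs ls ss lr sr : List ℕ) : Bool :=
  force true (lowerBound (ls.take d)) fun lw => force true (lowerBound (lr.take d)) fun l0 =>
  force true (lowerBound (ss.take d)) fun sw => force true (lowerBound (sr.take d)) fun s0 =>
  (Nat.ble 1 lw && Nat.ble 1 l0 && Nat.ble 1 sw && Nat.ble 1 s0) &&
  (Nat.blt C (Nat.add l0 s0) || Nat.blt C (Nat.add lw sw) ||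
    narrow C w (Nat.add l0 1 :: (cl ++ [Nat.add lw 1])) (Nat.add s0 1 :: (cs ++ [Nat.add sw 1])))

/-- A cheap test of a complete profile, followed by a thorough one. -/
def leaf (C w : ℕ) (ls ss : List ℕ) : Bool :=
  leafTest C w 3 ls.reverse ss.reverse ls ss ls.reverse ss.reverse ||
  leafTest C w w (refined [] ls.reverse) (refined [] ss.reverse) ls ss ls.reverse ss.reverse

/-- Whether no profile extends the given lowest rows by `n` further rows. A row consists of the
lattice points with abscissas from `l` to `C - s`; the lists `ls` and `ss` hold the values `l` and
`s` from top to bottom, and `rem` is the number of lattice points that are left. -/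
def search (C w : ℕ) (ok : ℕ → Bool) : ℕ → List ℕ → List ℕ → ℕ → Bool
  | 0, ls, ss, rem => cond (ok rem) (leaf C w ls ss) true
  | n + 1, ls, ss, rem =>
    force true (lowerBound ls) fun l0 => force true (lowerBound ss) fun s0 =>
    cond (Nat.ble 1 l0 && Nat.ble 1 s0)
     (allBelow (Nat.sub (Nat.add C 1) (Nat.add l0 s0)) fun i =>
      force true (Nat.add l0 i) fun l =>
      allBelow (Nat.sub rem n) fun j =>
      force true (Nat.sub C (Nat.add l j)) fun s =>
      cond (Nat.ble s0 s)
        (force true (Nat.sub rem (Nat.add j 1)) fun rem' =>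
          search C w ok n (l :: ls) (s :: ss) rem') true)
     false

/-- Whether `g = G - rem` is one of the numbers of points to be excluded for width `w`. -/
def goal (w G rem : ℕ) : Bool :=
  force true (Nat.sub G rem) fun g =>
    cond (Nat.ble 7 g) (cond (Nat.beq g 10) false (Nat.ble (Nat.add g 2) (Nat.mul 2 w))) false

/-- The search started from all pairs of lowest rows, whose leftmost points are sheared to have
abscissa `100`. -/
def start (w G : ℕ) : Bool :=
  allBelow G fun i => allBelow G fun j =>
    cond (Nat.ble (Nat.add i (Nat.add j 2)) G)
      (force true (Nat.sub 100 i) fun s1 => force true (Nat.sub 100 j) fun s2 =>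
        force true (Nat.sub G (Nat.add i (Nat.add j 2))) fun rem =>
        search 200 w (goal w G) (Nat.sub w 3) [100, 100] [s2, s1] rem)
      true

/-! ### Soundness of the search -/

/-- `Supports L w y X` says that a point with abscissa `X` in row `y` is compatible with `L i`
being the abscissa of the leftmost interior lattice point in row `i`, for `0 < i < w`: the segment
from that point to `(L k, k)` passes strictly to the right of `(L i - 1, i)` for every row `i`
strictly between `y` and `k`. -/
def Supports (L : ℕ → ℤ) (w y : ℕ) (X : ℤ) : Prop :=
  (∀ i k, y < i → i < k → k < w →
    ((k : ℤ) - y) * (L i - 1) < ((k : ℤ) - i) * X + ((i : ℤ) - y) * L k) ∧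
  (∀ i k, 0 < k → k < i → i < y → i < w →
    ((y : ℤ) - k) * (L i - 1) < ((i : ℤ) - k) * X + ((y : ℤ) - i) * L k)

/-- What the search uses about one side of a polygon with vertices in `V`: `h` is the abscissa, or
its reflection for the right-hand side, and `L y` is the least value of `h` on the interior lattice
points in row `y`. -/
structure Side (V : Set (ℤ × ℤ)) (w : ℕ) (h : ℤ × ℤ → ℤ) (L : ℕ → ℤ) : Prop where
  row : ∀ y, 0 < y → y < w → Supports L w y (L y)
  pt : ∀ v ∈ V, ∀ y : ℕ, v.2 = y → Supports L w y (h v)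
  near : ∀ v ∈ V, ∀ y : ℕ, v.2 = y → 0 < y → y < w → L y - 1 ≤ h v

/-- A set of points in the strip `0 ≤ y ≤ w`, touching both of its sides, all of whose lattice
widths are at least `w`. -/
structure Slab (V : Set (ℤ × ℤ)) (w : ℤ) : Prop where
  nonneg : ∀ v ∈ V, 0 ≤ v.2
  le : ∀ v ∈ V, v.2 ≤ w
  exists_bot : ∃ v ∈ V, v.2 = 0
  exists_top : ∃ v ∈ V, v.2 = w
  wide : ∀ a b : ℤ, a ≠ 0 ∨ b ≠ 0 →
    ∃ u ∈ V, ∃ v ∈ V, w ≤ a * (u.1 - v.1) + b * (u.2 - v.2)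

/-- The entries of a list are the values of `f` at `0, 1, …`. -/
def Agrees (f : ℕ → ℤ) (xs : List ℕ) : Prop :=
  ∀ i (hi : i < xs.length), (xs[i] : ℤ) = f i

theorem Agrees.cons {f : ℕ → ℤ} {x : ℕ} {xs : List ℕ} (h0 : (x : ℤ) = f 0)
    (h : Agrees (fun i => f (i + 1)) xs) : Agrees f (x :: xs) := by
  intro i hi
  cases i with
  | zero => simpa using h0
  | succ i => simpa using h i (by simpa using hi)

theorem Agrees.reverse {L : ℕ → ℤ} {j : ℕ} {xs : List ℕ} (h : Agrees (fun i => L (j - i)) xs)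
    (hj : xs.length = j) : Agrees (fun i => L (i + 1)) xs.reverse := by
  intro i hi
  rw [List.length_reverse] at hi
  rw [List.getElem_reverse, h]
  beta_reduce
  congr 1
  omega

theorem Supports.fits_above {L : ℕ → ℤ} {w y : ℕ} {X : ℤ} (h : Supports L w y X) {xs : List ℕ}
    (ha : Agrees (fun i => L (y + 1 + i)) xs) (hl : y + xs.length < w) : Fits X 1 xs := by
  intro i j hij hi hj
  have := h.1 (y + 1 + i) (y + 1 + j) (by omega) (by omega) (by omega)
  rw [ha i hi, ha j hj]
  push_cast at this ⊢
  linarith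

theorem Supports.fits_below {L : ℕ → ℤ} {w y : ℕ} {X : ℤ} (h : Supports L w y X) {xs : List ℕ}
    (ha : Agrees (fun i => L (y - 1 - i)) xs) (hl : xs.length < y) (hy : y ≤ w) :
    Fits X 1 xs := by
  intro i j hij hi hj
  have := h.2 (y - 1 - i) (y - 1 - j) (by omega) (by omega) (by omega) (by omega)
  rw [ha i hi, ha j hj]
  push_cast [show 1 ≤ y by omega, show i ≤ y - 1 by omega, show j ≤ y - 1 by omega] at this ⊢
  linarith

theorem length_refined (below above : List ℕ) : (refined below above).length = above.length := by
  induction above generalizing below with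
  | nil => rfl
  | cons x above ih => simp [refined, ih]

theorem refined_le {L : ℕ → ℤ} {w : ℕ} {below above : List ℕ} {y : ℕ} (hy : 0 < y)
    (hb : Agrees (fun i => L (y - 1 - i)) below) (hbl : below.length = y - 1)
    (ha : Agrees (fun i => L (y + i)) above) (hal : y + above.length ≤ w)
    {X : ℤ} (i : ℕ) (hi : i < above.length) (hX : Supports L w (y + i) X)
    (hn : L (y + i) - 1 ≤ X) (hi' : i < (refined below above).length) :
    ((refined below above)[i] : ℤ) ≤ X + 1 := by
  induction above generalizing below y i with
  | nil => simp at hi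
  | cons x above ih =>
    have hx : (x : ℤ) = L y := ha 0 (by simp)
    have ha' : Agrees (fun i => L (y + 1 + i)) above := by
      intro k hk
      have := ha (k + 1) (by simpa using hk)
      simp only [List.getElem_cons_succ] at this
      rw [this]
      beta_reduce
      congr 1
      omega
    simp only [List.length_cons] at hal
    cases i with
    | zero =>
      simp only [Nat.add_zero] at hX hn
      have h1 := lowerBound_le_toNat (hX.fits_above ha' (by omega))
      have h2 := lowerBound_le_toNat (hX.fits_below hb (by omega) (by omega))
      simp only [refined, List.getElem_cons_zero, maxNat_eq]
      cases hx1 : Nat.ble 1 x with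
      | false => rw [cond_false]; linarith
      | true =>
      rw [Nat.ble_eq] at hx1
      rw [cond_true]
      have h3 : Nat.add (max (lowerBound below) (lowerBound above)) 1 =
        max (lowerBound below) (lowerBound above) + 1 := rfl
      rw [h3]
      omega
    | succ i =>
      simp only [refined, List.getElem_cons_succ]
      apply ih (y := y + 1) (by omega) _ _ ha' (by omega) i (by simpa using hi)
      · rw [show y + 1 + i = y + (i + 1) by omega]; exact hX
      · rw [show y + 1 + i = y + (i + 1) by omega]; exact hn
      · refine Agrees.cons (by simpa using hx) ?_
        intro k hk
        rw [hb k hk]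
        beta_reduce
        congr 1
        omega
      · simp only [List.length_cons]
        omega

/-- The entries of `cl`, for rows `1, …, w - 1`, are at most `h + 1` on `V`. -/
def Bounds (V : Set (ℤ × ℤ)) (w : ℕ) (h : ℤ × ℤ → ℤ) (cl : List ℕ) : Prop :=
  cl.length = w - 1 ∧ ∀ v ∈ V, ∀ i : ℕ, v.2 = (i + 1 : ℕ) → ∀ hi : i < cl.length,
    (cl[i] : ℤ) ≤ h v + 1

theorem Side.bounds_self {V : Set (ℤ × ℤ)} {w : ℕ} {h : ℤ × ℤ → ℤ} {L : ℕ → ℤ}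
    (hs : Side V w h L) {xs : List ℕ} (hx : Agrees (fun i => L (i + 1)) xs)
    (hl : xs.length = w - 1) : Bounds V w h xs := by
  refine ⟨hl, fun v hv i hi hil => ?_⟩
  rw [hx i hil]
  have := hs.near v hv (i + 1) hi (by omega) (by omega)
  linarith

theorem Side.bounds_refined {V : Set (ℤ × ℤ)} {w : ℕ} {h : ℤ × ℤ → ℤ} {L : ℕ → ℤ}
    (hs : Side V w h L) (hw : 1 ≤ w) {xs : List ℕ} (hx : Agrees (fun i => L (i + 1)) xs)
    (hl : xs.length = w - 1) : Bounds V w h (refined [] xs) := by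
  refine ⟨by rw [length_refined, hl], fun v hv i hi hil => ?_⟩
  have hil' : i < xs.length := by rwa [length_refined] at hil
  apply refined_le (L := L) (w := w) (y := 1) (by omega) (fun k hk => by simp at hk) rfl _
    (by omega) i hil' _ _ hil
  · intro k hk
    rw [hx k hk]
    beta_reduce
    rw [Nat.add_comm]
  · rw [Nat.add_comm]; exact hs.pt v hv _ hi
  · rw [Nat.add_comm]; exact hs.near v hv _ hi (by omega) (by omega)

/-- Adding the bounds for rows `0` and `w` to a list of bounds. -/
theorem Bounds.extend {V : Set (ℤ × ℤ)} {w : ℕ} {h : ℤ × ℤ → ℤ} {cl : List ℕ}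
    (hb : Bounds V w h cl) (hw : 1 ≤ w) {l0 lw : ℕ} (h0 : ∀ v ∈ V, v.2 = 0 → (l0 : ℤ) ≤ h v)
    (h1 : ∀ v ∈ V, v.2 = w → (lw : ℤ) ≤ h v) (v : ℤ × ℤ) (hv : v ∈ V) (y : ℕ) (hy : v.2 = y)
    (hyl : y < (Nat.add l0 1 :: (cl ++ [Nat.add lw 1])).length) :
    (((Nat.add l0 1 :: (cl ++ [Nat.add lw 1]))[y] : ℕ) : ℤ) ≤ h v + 1 := by
  have hl := hb.1
  cases y with
  | zero =>
    have := h0 v hv (by simpa using hy)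
    simp only [List.getElem_cons_zero, Nat.add_eq]
    push_cast
    linarith
  | succ y =>
    simp only [List.getElem_cons_succ]
    by_cases hyc : y < cl.length
    · rw [List.getElem_append_left hyc]
      exact hb.2 v hv y hy hyc
    · rw [List.getElem_append_right (by omega)]
      simp only [List.length_cons, List.length_append, List.length_nil] at hyl
      have := h1 v hv (by rw [hy]; norm_cast; omega)
      simp only [List.getElem_singleton, Nat.add_eq]
      push_cast
      linarith

theorem not_narrow {V : Set (ℤ × ℤ)} {w C : ℕ} (hV : Slab V w) {cl cs : List ℕ}
    (hl : cl.length = w + 1) (hs : cs.length = w + 1)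
    (hcl : ∀ v ∈ V, ∀ y : ℕ, v.2 = y → ∀ hy : y < cl.length, (cl[y] : ℤ) ≤ v.1 + 1)
    (hcs : ∀ v ∈ V, ∀ y : ℕ, v.2 = y → ∀ hy : y < cs.length, (cs[y] : ℤ) ≤ C - v.1 + 1) :
    narrow C w cl cs = false := by
  have row : ∀ v ∈ V, ∃ y : ℕ, v.2 = y ∧ y < w + 1 := by
    intro v hv
    have h0 := hV.nonneg v hv
    have h1 := hV.le v hv
    exact ⟨v.2.toNat, by omega, by omega⟩
  have key1 : ∀ t : ℕ, narrowAlong C w t cl cs = false := by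
    intro t
    by_contra hn
    rw [Bool.not_eq_false] at hn
    obtain ⟨u, hu, v, hv, huv⟩ := hV.wide 1 t (Or.inl one_ne_zero)
    obtain ⟨i, hi, hi'⟩ := row v hv
    obtain ⟨j, hj, hj'⟩ := row u hu
    have h1 := lt_of_narrowAlong hn hs (i := i) (j := j) (by omega) (by omega)
    have h2 := hcl v hv i hi (by omega)
    have h3 := hcs u hu j hj (by omega)
    rw [hi, hj] at huv
    linarith
  have key2 : ∀ t : ℕ, narrowAlong C w t cs cl = false := by
    intro t
    by_contra hn
    rw [Bool.not_eq_false] at hn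
    obtain ⟨u, hu, v, hv, huv⟩ := hV.wide 1 (-t) (Or.inl one_ne_zero)
    obtain ⟨i, hi, hi'⟩ := row u hu
    obtain ⟨j, hj, hj'⟩ := row v hv
    have h1 := lt_of_narrowAlong hn hl (i := i) (j := j) (by omega) (by omega)
    have h2 := hcs u hu i hi (by omega)
    have h3 := hcl v hv j hj (by omega)
    rw [hi, hj] at huv
    linarith
  simp [narrow, key1, key2]

/-- The data of a polygon that the search works with: its vertices lie in `V`, and the interior
lattice points in row `y` are those with abscissas from `L y` to `C - S y`. -/
structure Profile (V : Set (ℤ × ℤ)) (w C : ℕ) (L S : ℕ → ℤ) : Prop where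
  slab : Slab V w
  left : Side V w (fun v => v.1) L
  right : Side V w (fun v => C - v.1) S
  nonempty : ∀ y, 0 < y → y < w → L y + S y ≤ C

theorem Profile.leafTest_eq_false {V : Set (ℤ × ℤ)} {w C : ℕ} {L S : ℕ → ℤ}
    (P : Profile V w C L S) (hw : 1 ≤ w) {ls ss cl cs : List ℕ} (d : ℕ)
    (hls : Agrees (fun i => L (w - 1 - i)) ls) (hss : Agrees (fun i => S (w - 1 - i)) ss)
    (hl : ls.length = w - 1) (hs : ss.length = w - 1)
    (hcl : Bounds V w (fun v => v.1) cl) (hcs : Bounds V w (fun v => C - v.1) cs) :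
    leafTest C w d cl cs ls ss ls.reverse ss.reverse = false := by
  have top : ∀ (h : ℤ × ℤ → ℤ) (M : ℕ → ℤ) (xs : List ℕ), Side V w h M →
      Agrees (fun i => M (w - 1 - i)) xs → xs.length = w - 1 → 1 ≤ lowerBound (xs.take d) →
      ∀ v ∈ V, v.2 = w → (lowerBound (xs.take d) : ℤ) ≤ h v := by
    intro h M xs hM hx hxl hb v hv hvw
    exact lowerBound_le (((hM.pt v hv w hvw).fits_below hx (by omega) le_rfl).take d) hb
  have bot : ∀ (h : ℤ × ℤ → ℤ) (M : ℕ → ℤ) (xs : List ℕ), Side V w h M →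
      Agrees (fun i => M (w - 1 - i)) xs → xs.length = w - 1 →
      1 ≤ lowerBound (xs.reverse.take d) →
      ∀ v ∈ V, v.2 = 0 → (lowerBound (xs.reverse.take d) : ℤ) ≤ h v := by
    intro h M xs hM hx hxl hb v hv hvw
    refine lowerBound_le (((hM.pt v hv 0 (by simpa using hvw)).fits_above (xs := xs.reverse)
      ?_ (by simp; omega)).take d) hb
    intro i hi
    rw [hx.reverse hxl i hi]
    beta_reduce
    congr 1
    omega
  by_contra hn
  rw [Bool.not_eq_false] at hn
  simp only [leafTest, force_eq, Bool.and_eq_true, Bool.or_eq_true, Nat.ble_eq] at hn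
  obtain ⟨⟨⟨⟨b1, b2⟩, b3⟩, b4⟩, hn⟩ := hn
  have t1 := top _ _ _ P.left hls hl b1
  have t2 := bot _ _ _ P.left hls hl b2
  have t3 := top _ _ _ P.right hss hs b3
  have t4 := bot _ _ _ P.right hss hs b4
  rcases hn with (hn | hn) | hn
  · obtain ⟨v, hv, hv0⟩ := P.slab.exists_bot
    have h1 := t2 v hv hv0
    have h2 := t4 v hv hv0
    simp only [Nat.blt, Nat.ble_eq, Nat.add_eq] at hn
    omega
  · obtain ⟨v, hv, hv0⟩ := P.slab.exists_top
    have h1 := t1 v hv hv0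
    have h2 := t3 v hv hv0
    simp only [Nat.blt, Nat.ble_eq, Nat.add_eq] at hn
    omega
  · rw [not_narrow P.slab (by simp [hcl.1]; omega) (by simp [hcs.1]; omega)
      (hcl.extend hw t2 t1) (hcs.extend hw t4 t3)] at hn
    exact absurd hn (by simp)

theorem Profile.leaf_eq_false {V : Set (ℤ × ℤ)} {w C : ℕ} {L S : ℕ → ℤ}
    (P : Profile V w C L S) (hw : 1 ≤ w) {ls ss : List ℕ}
    (hls : Agrees (fun i => L (w - 1 - i)) ls) (hss : Agrees (fun i => S (w - 1 - i)) ss)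
    (hl : ls.length = w - 1) (hs : ss.length = w - 1) : leaf C w ls ss = false := by
  have hl' : ls.reverse.length = w - 1 := by simpa using hl
  have hs' : ss.reverse.length = w - 1 := by simpa using hs
  rw [leaf, P.leafTest_eq_false hw 3 hls hss hl hs (P.left.bounds_self (hls.reverse hl) hl')
    (P.right.bounds_self (hss.reverse hs) hs'),
    P.leafTest_eq_false hw w hls hss hl hs (P.left.bounds_refined hw (hls.reverse hl) hl')
    (P.right.bounds_refined hw (hss.reverse hs) hs')]
  rfl

/-- The number of interior lattice points in the rows `1, …, j`. -/
def countUpTo (C : ℕ) (L S : ℕ → ℤ) (j : ℕ) : ℤ :=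
  ∑ y ∈ Finset.Icc 1 j, (C + 1 - L y - S y)

theorem countUpTo_succ (C : ℕ) (L S : ℕ → ℤ) (j : ℕ) :
    countUpTo C L S (j + 1) = countUpTo C L S j + (C + 1 - L (j + 1) - S (j + 1)) := by
  rw [countUpTo, countUpTo, Finset.sum_Icc_succ_top (by omega)]

theorem Profile.countUpTo_add_le {V : Set (ℤ × ℤ)} {w C : ℕ} {L S : ℕ → ℤ}
    (P : Profile V w C L S) (j n : ℕ) (h : j + n < w) :
    countUpTo C L S j + n ≤ countUpTo C L S (j + n) := by
  induction n with
  | zero => simp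
  | succ n ih =>
    have h1 := ih (by omega)
    have h2 := P.nonempty (j + n + 1) (by omega) (by omega)
    rw [← Nat.add_assoc, countUpTo_succ]
    push_cast
    linarith

theorem Profile.search_eq_false {V : Set (ℤ × ℤ)} {w C : ℕ} {L S : ℕ → ℤ}
    (P : Profile V w C L S) (hw : 1 ≤ w) {G g : ℕ} (hg : countUpTo C L S (w - 1) = g)
    (hgG : g ≤ G) {ok : ℕ → Bool} (hok : ok (G - g) = true) (n j : ℕ) (hj : j + n = w - 1)
    (ls ss : List ℕ) (rem : ℕ) (hl : ls.length = j) (hs : ss.length = j)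
    (hls : Agrees (fun i => L (j - i)) ls) (hss : Agrees (fun i => S (j - i)) ss)
    (hrem : (rem : ℤ) = G - countUpTo C L S j) : search C w ok n ls ss rem = false := by
  induction n generalizing j ls ss rem with
  | zero =>
    have hjw : j = w - 1 := by omega
    subst hjw
    have : rem = G - g := by omega
    rw [search, this, hok, cond_true]
    exact P.leaf_eq_false hw hls hss hl hs
  | succ n ih =>
    by_contra hn
    rw [Bool.not_eq_false] at hn
    simp only [search, force_eq] at hn
    cases hb : (Nat.ble 1 (lowerBound ls) && Nat.ble 1 (lowerBound ss)) with
    | false => simp [hb] at hn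
    | true =>
      rw [hb, cond_true] at hn
      simp only [Bool.and_eq_true, Nat.ble_eq] at hb
      have hjw : j + 1 < w := by omega
      have hL : (lowerBound ls : ℤ) ≤ L (j + 1) :=
        lowerBound_le ((P.left.row (j + 1) (by omega) hjw).fits_below hls (by omega) (by omega))
          hb.1
      have hS : (lowerBound ss : ℤ) ≤ S (j + 1) :=
        lowerBound_le ((P.right.row (j + 1) (by omega) hjw).fits_below hss (by omega) (by omega))
          hb.2
      have hne := P.nonempty (j + 1) (by omega) hjw
      have hcount := P.countUpTo_add_le (j + 1) n (by omega)
      rw [show j + 1 + n = w - 1 by omega, hg, countUpTo_succ] at hcount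
      obtain ⟨l, hl'⟩ : ∃ l : ℕ, (l : ℤ) = L (j + 1) := ⟨(L (j + 1)).toNat, by omega⟩
      obtain ⟨s, hs'⟩ : ∃ s : ℕ, (s : ℤ) = S (j + 1) := ⟨(S (j + 1)).toNat, by omega⟩
      rw [← hl', ← hs'] at hne hcount
      rw [← hl'] at hL
      rw [← hs'] at hS
      have h1 := of_allBelow hn (l - lowerBound ls) (by simp only [Nat.sub_eq, Nat.add_eq]; omega)
      have e1 : Nat.add (lowerBound ls) (l - lowerBound ls) = l := by
        simp only [Nat.add_eq]; omega
      rw [e1] at h1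
      have h2 := of_allBelow h1 (C - l - s) (by simp only [Nat.sub_eq]; omega)
      have e2 : Nat.sub C (Nat.add l (C - l - s)) = s := by
        simp only [Nat.sub_eq, Nat.add_eq]; omega
      rw [e2, Nat.ble_eq.mpr (by omega), cond_true] at h2
      rw [ih (j + 1) (by omega) (l :: ls) (s :: ss) (Nat.sub rem (Nat.add (C - l - s) 1))
        (by simp [hl]) (by simp [hs]) (Agrees.cons (by simpa using hl') ?_)
        (Agrees.cons (by simpa using hs') ?_) ?_] at h2
      · exact absurd h2 (by simp)
      · intro i hi; rw [hls i hi]; beta_reduce; congr 1; omega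
      · intro i hi; rw [hss i hi]; beta_reduce; congr 1; omega
      · rw [countUpTo_succ, ← hl', ← hs']
        simp only [Nat.sub_eq, Nat.add_eq]
        omega

/-- The result of the search, found by evaluation in the kernel. -/
theorem start_eq_true (w : ℕ) (h5 : 5 ≤ w) (h13 : w ≤ 13) :
    start w (cond (Nat.ble 7 w) 12 (2 * w - 2)) = true := by
  interval_cases w <;> decide +kernel

/-- There is no profile with the given numbers of points. The first two rows are assumed to begin
at the same abscissa `100`, which a shear achieves. -/
theorem Profile.contradiction {V : Set (ℤ × ℤ)} {w : ℕ} {L S : ℕ → ℤ} (P : Profile V w 200 L S)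
    (hw : 5 ≤ w) {g : ℕ} (hg : countUpTo 200 L S (w - 1) = g) (hg7 : 7 ≤ g) (hg12 : g ≤ 12)
    (hg10 : g ≠ 10) (hgw : g + 2 ≤ 2 * w) (hL1 : L 1 = 100) (hL2 : L 2 = 100) : False := by
  have hw13 : w ≤ 13 := by
    have := P.countUpTo_add_le 0 (w - 1) (by omega)
    rw [Nat.zero_add, hg] at this
    simp only [countUpTo, zero_lt_one, Finset.Icc_eq_empty_of_lt,
      Finset.sum_empty] at this
    omega
  obtain ⟨G, hG, hgG, hG12⟩ : ∃ G, G = cond (Nat.ble 7 w) 12 (2 * w - 2) ∧ g ≤ G ∧ G ≤ 12 := by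
    refine ⟨_, rfl, ?_⟩
    cases hb : Nat.ble 7 w with
    | true => exact ⟨hg12, le_rfl⟩
    | false =>
      have : ¬ 7 ≤ w := by
        intro h
        rw [Nat.ble_eq.mpr h] at hb
        exact absurd hb (by simp)
      simp only [cond_false]
      omega
  have hstart := start_eq_true w hw hw13
  rw [← hG] at hstart
  have hne1 := P.nonempty 1 (by omega) (by omega)
  have hne2 := P.nonempty 2 (by omega) (by omega)
  have hcount := P.countUpTo_add_le 2 (w - 3) (by omega)
  have hc2 : countUpTo 200 L S 2 = (201 - L 1 - S 1) + (201 - L 2 - S 2) := by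
    rw [countUpTo_succ, countUpTo_succ]
    simp [countUpTo]
  rw [show 2 + (w - 3) = w - 1 by omega, hg, hc2] at hcount
  have hok : goal w G (G - g) = true := by
    have e : Nat.sub G (G - g) = g := by simp only [Nat.sub_eq]; omega
    have e10 : Nat.beq g 10 = false := by
      rw [← Bool.not_eq_true, Nat.beq_eq]
      exact hg10
    rw [goal, force_eq, e, Nat.ble_eq.mpr hg7, cond_true, e10, cond_false]
    exact Nat.ble_eq.mpr hgw
  obtain ⟨s1, hs1⟩ : ∃ s : ℕ, (s : ℤ) = S 1 := ⟨(S 1).toNat, by omega⟩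
  obtain ⟨s2, hs2⟩ : ∃ s : ℕ, (s : ℤ) = S 2 := ⟨(S 2).toNat, by omega⟩
  have h1 := of_allBelow (of_allBelow hstart (100 - s1) (by omega)) (100 - s2) (by omega)
  have e0 : Nat.ble (Nat.add (100 - s1) (Nat.add (100 - s2) 2)) G = true := by
    apply Nat.ble_eq.mpr
    simp only [Nat.add_eq]
    omega
  have e1 : Nat.sub 100 (100 - s1) = s1 := by simp only [Nat.sub_eq]; omega
  have e2 : Nat.sub 100 (100 - s2) = s2 := by simp only [Nat.sub_eq]; omega
  rw [e0, cond_true, force_eq, force_eq, force_eq, e1, e2] at h1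
  rw [P.search_eq_false (by omega) hg hgG hok (Nat.sub w 3) 2 (by simp only [Nat.sub_eq]; omega)
    [100, 100] [s2, s1] _ rfl rfl ?_ ?_ ?_] at h1
  · exact absurd h1 (by simp)
  · exact Agrees.cons (by simp [hL2]) (Agrees.cons (by simp [hL1]) fun i hi => by simp at hi)
  · exact Agrees.cons (by simp [hs2]) (Agrees.cons (by simp [hs1]) fun i hi => by simp at hi)
  · rw [hc2]
    simp only [Nat.sub_eq, Nat.add_eq]
    omega

/-! ### Interior lattice points and unimodular maps -/

/-- The lattice points `p` such that every nonzero linear functional is larger somewhere on `V`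
than at `p`: these are the lattice points in the interior of the convex hull of `V`. -/
def IntPts (V : Set (ℤ × ℤ)) : Set (ℤ × ℤ) :=
  {p | ∀ a b : ℝ, a ≠ 0 ∨ b ≠ 0 → ∃ v ∈ V, a * p.1 + b * p.2 < a * v.1 + b * v.2}

/-- The affine map with linear part `(x, y) ↦ (e x + f y, a x + b y)` and translation part
`(s, t)`. -/
def aff (e f a b s t : ℤ) (p : ℤ × ℤ) : ℤ × ℤ :=
  (e * p.1 + f * p.2 + s, a * p.1 + b * p.2 + t)

section aff

variable {e f a b s t : ℤ}

theorem aff_bijective (hD : (e * b - f * a) * (e * b - f * a) = 1) :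
    Function.Bijective (aff e f a b s t) := by
  rw [Function.bijective_iff_has_inverse]
  set D := e * b - f * a with hDdef
  refine ⟨fun q => (D * (b * (q.1 - s) - f * (q.2 - t)), D * (e * (q.2 - t) - a * (q.1 - s))),
    fun p => ?_, fun q => ?_⟩
  · ext
    · simp only [aff]
      linear_combination p.1 * hD - D * p.1 * hDdef
    · simp only [aff]
      linear_combination p.2 * hD - D * p.2 * hDdef
  · ext
    · simp only [aff]
      linear_combination (q.1 - s) * hD - D * (q.1 - s) * hDdef
    · simp only [aff]
      linear_combination (q.2 - t) * hD - D * (q.2 - t) * hDdef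

theorem aff_mem_intPts {V : Set (ℤ × ℤ)} (hD : (e * b - f * a) * (e * b - f * a) = 1)
    (p : ℤ × ℤ) : aff e f a b s t p ∈ IntPts (aff e f a b s t '' V) ↔ p ∈ IntPts V := by
  have hD' : ((e : ℝ) * b - f * a) * (e * b - f * a) = 1 := by exact_mod_cast hD
  set D : ℝ := (e : ℝ) * b - f * a with hDdef
  constructor
  · intro h α β hαβ
    obtain ⟨_, ⟨v, hv, rfl⟩, hlt⟩ := h (D * (α * b - β * a)) (D * (β * e - α * f)) (by
      by_contra hcon
      push Not at hcon
      have h1 : α = 0 := by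
        linear_combination e * hcon.1 + a * hcon.2 - α * hD' + D * α * hDdef
      have h2 : β = 0 := by
        linear_combination f * hcon.1 + b * hcon.2 - β * hD' + D * β * hDdef
      tauto)
    refine ⟨v, hv, ?_⟩
    have key : ∀ q : ℤ × ℤ, D * (α * b - β * a) * ((aff e f a b s t q).1 : ℝ) +
        D * (β * e - α * f) * ((aff e f a b s t q).2 : ℝ) =
        α * q.1 + β * q.2 + (D * (α * b - β * a) * s + D * (β * e - α * f) * t) := by
      intro q
      simp only [aff]
      push_cast
      linear_combination (α * q.1 + β * q.2) * hD' - D * (α * q.1 + β * q.2) * hDdef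
    rw [key, key] at hlt
    linarith
  · intro h α β hαβ
    obtain ⟨v, hv, hlt⟩ := h (α * e + β * a) (α * f + β * b) (by
      by_contra hcon
      push Not at hcon
      have h1 : α = 0 := by
        linear_combination D * b * hcon.1 - D * a * hcon.2 - α * hD' + D * α * hDdef
      have h2 : β = 0 := by
        linear_combination D * e * hcon.2 - D * f * hcon.1 - β * hD' + D * β * hDdef
      tauto)
    refine ⟨_, ⟨v, hv, rfl⟩, ?_⟩
    simp only [aff]
    push_cast
    linarith

theorem intPts_image_aff {V : Set (ℤ × ℤ)} (hD : (e * b - f * a) * (e * b - f * a) = 1) :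
    IntPts (aff e f a b s t '' V) = aff e f a b s t '' IntPts V := by
  ext q
  obtain ⟨p, rfl⟩ := (aff_bijective (s := s) (t := t) hD).2 q
  rw [aff_mem_intPts hD, (aff_bijective hD).1.mem_set_image]

theorem ncard_intPts_image_aff {V : Set (ℤ × ℤ)}
    (hD : (e * b - f * a) * (e * b - f * a) = 1) :
    (IntPts (aff e f a b s t '' V)).ncard = (IntPts V).ncard := by
  rw [intPts_image_aff hD, Set.ncard_image_of_injective _ (aff_bijective hD).1]

theorem wide_image_aff {V : Set (ℤ × ℤ)} {w : ℤ} (hD : (e * b - f * a) * (e * b - f * a) = 1)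
    (h : ∀ α β : ℤ, α ≠ 0 ∨ β ≠ 0 →
      ∃ u ∈ V, ∃ v ∈ V, w ≤ α * (u.1 - v.1) + β * (u.2 - v.2)) :
    ∀ α β : ℤ, α ≠ 0 ∨ β ≠ 0 → ∃ u ∈ aff e f a b s t '' V, ∃ v ∈ aff e f a b s t '' V,
      w ≤ α * (u.1 - v.1) + β * (u.2 - v.2) := by
  intro α β hαβ
  set D := e * b - f * a with hDdef
  obtain ⟨u, hu, v, hv, huv⟩ := h (α * e + β * a) (α * f + β * b) (by
    by_contra hcon
    push Not at hcon
    have h1 : α = 0 := by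
      linear_combination D * b * hcon.1 - D * a * hcon.2 - α * hD + D * α * hDdef
    have h2 : β = 0 := by
      linear_combination D * e * hcon.2 - D * f * hcon.1 - β * hD + D * β * hDdef
    tauto)
  refine ⟨_, ⟨u, hu, rfl⟩, _, ⟨v, hv, rfl⟩, ?_⟩
  simp only [aff]
  linarith

end aff

theorem Slab.shear {V : Set (ℤ × ℤ)} {w : ℤ} (h : Slab V w) (k s : ℤ) :
    Slab (aff 1 k 0 1 s 0 '' V) w where
  nonneg := by
    rintro _ ⟨v, hv, rfl⟩
    simpa [aff] using h.nonneg v hv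
  le := by
    rintro _ ⟨v, hv, rfl⟩
    simpa [aff] using h.le v hv
  exists_bot := by
    obtain ⟨v, hv, h0⟩ := h.exists_bot
    exact ⟨_, ⟨v, hv, rfl⟩, by simpa [aff] using h0⟩
  exists_top := by
    obtain ⟨v, hv, h0⟩ := h.exists_top
    exact ⟨_, ⟨v, hv, rfl⟩, by simpa [aff] using h0⟩
  wide := wide_image_aff (by norm_num) h.wide

theorem Slab.rotate {V : Set (ℤ × ℤ)} {w : ℤ} (h : Slab V w) :
    Slab (aff (-1) 0 0 (-1) 0 w '' V) w where
  nonneg := by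
    rintro _ ⟨v, hv, rfl⟩
    have := h.le v hv
    simp only [aff]
    linarith
  le := by
    rintro _ ⟨v, hv, rfl⟩
    have := h.nonneg v hv
    simp only [aff]
    linarith
  exists_bot := by
    obtain ⟨v, hv, h0⟩ := h.exists_top
    exact ⟨_, ⟨v, hv, rfl⟩, by simp [aff, h0]⟩
  exists_top := by
    obtain ⟨v, hv, h0⟩ := h.exists_bot
    exact ⟨_, ⟨v, hv, rfl⟩, by simp [aff, h0]⟩
  wide := wide_image_aff (by norm_num) h.wide

theorem Slab.row_mem {V : Set (ℤ × ℤ)} {w : ℤ} (h : Slab V w) {p : ℤ × ℤ} (hp : p ∈ IntPts V) :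
    0 < p.2 ∧ p.2 < w := by
  constructor
  · obtain ⟨v, hv, hlt⟩ := hp 0 (-1) (by norm_num)
    have := h.nonneg v hv
    have h2 : (v.2 : ℝ) < p.2 := by linarith
    have h3 : v.2 < p.2 := by exact_mod_cast h2
    omega
  · obtain ⟨v, hv, hlt⟩ := hp 0 1 (by norm_num)
    have := h.le v hv
    have h2 : (p.2 : ℝ) < v.2 := by linarith
    have h3 : p.2 < v.2 := by exact_mod_cast h2
    omega

/-! ### Every inner row contains an interior lattice point -/

theorem Slab.exists_line {V : Set (ℤ × ℤ)} {w : ℤ} (h : Slab V w) {x j : ℤ} (h0 : 0 < j)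
    (hw : j < w) (hp : (x, j) ∉ IntPts V) :
    (∃ σ : ℝ, ∀ v ∈ V, (x : ℝ) + σ * (v.2 - j) ≤ v.1) ∨
      ∃ σ : ℝ, ∀ v ∈ V, (v.1 : ℝ) ≤ x + σ * (v.2 - j) := by
  simp only [IntPts, Set.mem_ofPred_eq, not_forall, not_exists, not_and, not_lt] at hp
  obtain ⟨a, b, hab, hp⟩ := hp
  have h0' : (0 : ℝ) < j := by exact_mod_cast h0
  have hw' : (j : ℝ) < w := by exact_mod_cast hw
  rcases lt_trichotomy a 0 with ha | ha | ha
  · left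
    refine ⟨-b / a, fun v hv => ?_⟩
    have := hp v hv
    have e : a * (-b / a) = -b := mul_div_cancel₀ _ ha.ne
    by_contra hlt
    push Not at hlt
    have := mul_lt_mul_of_neg_left hlt ha
    have e2 : a * ((x : ℝ) + -b / a * (v.2 - j)) = a * x + -b * (v.2 - j) := by
      rw [mul_add, ← mul_assoc, e]
    rw [e2] at this
    linarith
  · exfalso
    obtain ⟨u, hu, hu0⟩ := h.exists_bot
    obtain ⟨v, hv, hv0⟩ := h.exists_top
    have h1 := hp u hu
    have h2 := hp v hv
    simp only [ha, hu0, hv0, zero_mul, zero_add, Int.cast_zero, mul_zero] at h1 h2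
    have hb : b = 0 := by
      apply le_antisymm <;> nlinarith
    rcases hab with h | h
    · exact h ha
    · exact h hb
  · right
    refine ⟨-b / a, fun v hv => ?_⟩
    have := hp v hv
    have e : a * (-b / a) = -b := mul_div_cancel₀ _ ha.ne'
    by_contra hlt
    push Not at hlt
    have := mul_lt_mul_of_pos_left hlt ha
    have e2 : a * ((x : ℝ) + -b / a * (v.2 - j)) = a * x + -b * (v.2 - j) := by
      rw [mul_add, ← mul_assoc, e]
    rw [e2] at this
    linarith

/-- If the row `j` contains no interior lattice point, then the polygon lies between two lines
through adjacent lattice points of that row. -/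
theorem Slab.exists_gap {V : Set (ℤ × ℤ)} {w : ℤ} (h : Slab V w) (hfin : V.Finite) {j : ℤ}
    (h0 : 0 < j) (hw : j < w) (hp : ∀ x, (x, j) ∉ IntPts V) :
    ∃ (m : ℤ) (σ τ : ℝ), ∀ v ∈ V,
      (m : ℝ) + σ * (v.2 - j) ≤ v.1 ∧ (v.1 : ℝ) ≤ m + 1 + τ * (v.2 - j) := by
  have hbd := (hfin.image Prod.fst)
  obtain ⟨m₀, hm₀⟩ := hbd.bddBelow
  obtain ⟨M, hM⟩ := hbd.bddAbove
  by_contra hcon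
  push Not at hcon
  have step : ∀ m : ℤ, (∃ σ : ℝ, ∀ v ∈ V, (m : ℝ) + σ * (v.2 - j) ≤ v.1) →
      ∃ σ : ℝ, ∀ v ∈ V, ((m + 1 : ℤ) : ℝ) + σ * (v.2 - j) ≤ v.1 := by
    rintro m ⟨σ, hσ⟩
    rcases h.exists_line h0 hw (hp (m + 1)) with h1 | ⟨τ, hτ⟩
    · exact h1
    · exfalso
      obtain ⟨v, hv, hlt⟩ := hcon m σ τ
      have h1 := hτ v hv
      push_cast at h1
      exact absurd (hlt (hσ v hv)) (not_lt.mpr h1)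
  have all : ∀ n : ℕ, ∃ σ : ℝ, ∀ v ∈ V, ((m₀ + n : ℤ) : ℝ) + σ * (v.2 - j) ≤ v.1 := by
    intro n
    induction n with
    | zero =>
      refine ⟨0, fun v hv => ?_⟩
      have : m₀ ≤ v.1 := hm₀ (Set.mem_image_of_mem _ hv)
      have : (m₀ : ℝ) ≤ v.1 := by exact_mod_cast this
      simpa using this
    | succ n ih =>
      have := step _ ih
      push_cast at this ⊢
      simpa [add_assoc] using this
  obtain ⟨u, hu, hu0⟩ := h.exists_bot
  obtain ⟨v, hv, hv0⟩ := h.exists_top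
  obtain ⟨σ, hσ⟩ := all (M + 1 - m₀).toNat
  have hmM : m₀ ≤ M := (hm₀ (Set.mem_image_of_mem _ hu)).trans (hM (Set.mem_image_of_mem _ hu))
  have e : (m₀ + ((M + 1 - m₀).toNat : ℤ) : ℤ) = M + 1 := by omega
  rw [e] at hσ
  have h1 := hσ u hu
  have h2 := hσ v hv
  have h3 : (u.1 : ℝ) ≤ M := by exact_mod_cast hM (Set.mem_image_of_mem _ hu)
  have h4 : (v.1 : ℝ) ≤ M := by exact_mod_cast hM (Set.mem_image_of_mem _ hv)
  rw [hu0] at h1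
  rw [hv0] at h2
  push_cast at h1 h2
  have h5 : (0 : ℝ) < j := by exact_mod_cast h0
  have h6 : (j : ℝ) < w := by exact_mod_cast hw
  -- the slope would have to be both positive and negative
  have h7 : 0 < σ := by nlinarith
  nlinarith

/-- If the two lines of `Slab.exists_gap` converge upwards, then the polygon is contained in a
unimodular image of the triangle with vertices `(0, 0)`, `(w, 0)`, `(0, w)`. Otherwise one of the
functionals `x - t y`, for the two integers `t` next to the slopes, would be too narrow. -/
theorem Slab.subset_triangle {V : Set (ℤ × ℤ)} {w : ℤ} (h : Slab V w) (hw3 : 3 ≤ w) {j m : ℤ}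
    (h0 : 0 < j) (hw : j < w) {σ τ : ℝ} (hστ : τ ≤ σ) (hV : ∀ v ∈ V,
      (m : ℝ) + σ * (v.2 - j) ≤ v.1 ∧ (v.1 : ℝ) ≤ m + 1 + τ * (v.2 - j)) :
    ∃ k s : ℤ, ∀ v ∈ V, 0 ≤ v.1 + k * v.2 + s ∧ v.1 + k * v.2 + s + v.2 ≤ w := by
  have hw3' : (3 : ℝ) ≤ w := by exact_mod_cast hw3
  have h0' : (0 : ℝ) < j := by exact_mod_cast h0
  have hw' : (j : ℝ) + 1 ≤ w := by exact_mod_cast hw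
  have width : ∀ t : ℤ, ∃ p q : ℝ, 0 ≤ p ∧ p ≤ w ∧ 0 ≤ q ∧ q ≤ w ∧
      (w : ℝ) ≤ 1 + (τ - t) * (p - j) - (σ - t) * (q - j) := by
    intro t
    obtain ⟨u, hu, v, hv, huv⟩ := h.wide 1 (-t) (Or.inl one_ne_zero)
    refine ⟨u.2, v.2, by exact_mod_cast h.nonneg u hu, by exact_mod_cast h.le u hu,
      by exact_mod_cast h.nonneg v hv, by exact_mod_cast h.le v hv, ?_⟩
    have h1 := (hV u hu).2
    have h2 := (hV v hv).1
    have h3 : (w : ℝ) ≤ 1 * (u.1 - v.1) + -t * (u.2 - v.2) := by exact_mod_cast huv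
    linarith
  obtain ⟨z, hz, hzw⟩ := h.exists_top
  have hz1 := (hV z hz).1
  have hz2 := (hV z hz).2
  rw [hzw] at hz1 hz2
  have hε : (σ - τ) * (w - j) ≤ 1 := by linarith
  by_cases hint : ∃ t : ℤ, τ ≤ t ∧ (t : ℝ) ≤ σ
  · obtain ⟨t, ht1, ht2⟩ := hint
    obtain ⟨p, q, hp0, hpw, hq0, hqw, hpq⟩ := width t
    have h1 : (τ - t) * (p - j) ≤ (t - τ) * j := by nlinarith
    have h2 : -((σ - t) * (q - j)) ≤ (σ - t) * j := by nlinarith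
    have h3 : (w : ℝ) - 1 ≤ (σ - τ) * j := by linarith
    have h4 : ((w : ℝ) - 1) * (w - j) ≤ j := by nlinarith
    have h5 : (w : ℝ) - j ≤ 1 := by
      by_contra hlt
      push Not at hlt
      have : ((w : ℝ) - 1) * 1 < (w - 1) * (w - j) := by
        apply mul_lt_mul_of_pos_left hlt; linarith
      linarith
    have hj : (j : ℝ) = w - 1 := by linarith
    have hj' : j = w - 1 := by
      have : (j : ℝ) = ((w - 1 : ℤ) : ℝ) := by push_cast; exact hj
      exact_mod_cast this
    rw [hj] at h3 hε hz1 hz2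
    have hε1 : σ - τ = 1 := by
      apply le_antisymm
      · linarith
      · by_contra hlt
        push Not at hlt
        nlinarith
    have hσ : ((z.1 - m : ℤ) : ℝ) = σ := by push_cast; linarith
    refine ⟨-(z.1 - m), (z.1 - m) * j - m, fun v hv => ?_⟩
    have h6 := (hV v hv).1
    have h7 := (hV v hv).2
    have hτ : τ = ((z.1 - m : ℤ) : ℝ) - 1 := by linarith
    rw [← hσ] at h6
    rw [hτ] at h7
    have h6' : m + (z.1 - m) * (v.2 - j) ≤ v.1 := by exact_mod_cast h6
    have h7' : v.1 ≤ m + 1 + ((z.1 - m) - 1) * (v.2 - j) := by exact_mod_cast h7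
    constructor
    · linarith
    · have : ((z.1 - m) - 1) * (v.2 - j) = (z.1 - m) * (v.2 - j) - v.2 + (w - 1) := by
        rw [← hj']; ring
      linarith
  · exfalso
    push Not at hint
    have f1 : (⌊τ⌋ : ℝ) < τ := by
      rcases (Int.floor_le τ).lt_or_eq with h1 | h1
      · exact h1
      · exact absurd (hint ⌊τ⌋ h1.ge) (not_lt.mpr (by rw [h1]; exact hστ))
    have f2 : σ < ⌊τ⌋ + 1 := by
      have := hint (⌊τ⌋ + 1) (by push_cast; exact (Int.lt_floor_add_one τ).le)
      exact_mod_cast this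
    set t := ⌊τ⌋ with ht
    obtain ⟨p, q, hp0, hpw, hq0, hqw, hpq⟩ := width t
    obtain ⟨p', q', hp0', hpw', hq0', hqw', hpq'⟩ := width (t + 1)
    push_cast at hpq'
    have h1 : (τ - t) * (p - j) ≤ (τ - t) * (w - j) := by
      apply mul_le_mul_of_nonneg_left <;> linarith
    have h2 : -((σ - t) * (q - j)) ≤ (σ - t) * j := by nlinarith
    have h3 : (τ - (t + 1)) * (p' - j) ≤ (t + 1 - τ) * j := by nlinarith
    have h4 : -((σ - (t + 1)) * (q' - j)) ≤ (t + 1 - σ) * (w - j) := by nlinarith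
    have h5 : (w : ℝ) - 2 ≤ (σ - τ) * (2 * j - w) := by linarith
    rcases lt_or_ge 0 (2 * (j : ℝ) - w) with h7 | h7
    · have h8 : (σ - τ) * (2 * j - w) < 1 * (2 * j - w) :=
        mul_lt_mul_of_pos_right (by linarith) h7
      linarith
    · have h8 : (σ - τ) * (2 * j - w) ≤ 0 :=
        mul_nonpos_of_nonneg_of_nonpos (by linarith) h7
      linarith

/-- The interior lattice points of the triangle with vertices `(0, 0)`, `(w, 0)`, `(0, w)`. -/
theorem intPts_triangle {V : Set (ℤ × ℤ)} {w : ℤ} (hw : 0 < w)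
    (hV : ∀ v ∈ V, 0 ≤ v.1 ∧ 0 ≤ v.2 ∧ v.1 + v.2 ≤ w) (h1 : (0, 0) ∈ V) (h2 : (w, 0) ∈ V)
    (h3 : (0, w) ∈ V) : IntPts V = {p | 1 ≤ p.1 ∧ 1 ≤ p.2 ∧ p.1 + p.2 ≤ w - 1} := by
  ext p
  constructor
  · intro hp
    refine ⟨?_, ?_, ?_⟩
    · obtain ⟨v, hv, hlt⟩ := hp (-1) 0 (by norm_num)
      have h4 : (v.1 : ℝ) < p.1 := by linarith
      have h5 : v.1 < p.1 := by exact_mod_cast h4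
      have := hV v hv
      omega
    · obtain ⟨v, hv, hlt⟩ := hp 0 (-1) (by norm_num)
      have h4 : (v.2 : ℝ) < p.2 := by linarith
      have h5 : v.2 < p.2 := by exact_mod_cast h4
      have := hV v hv
      omega
    · obtain ⟨v, hv, hlt⟩ := hp 1 1 (by norm_num)
      have h4 : ((p.1 + p.2 : ℤ) : ℝ) < (v.1 + v.2 : ℤ) := by push_cast; linarith
      have h5 : p.1 + p.2 < v.1 + v.2 := by exact_mod_cast h4
      have := hV v hv
      omega
  · rintro ⟨p1, p2, p3⟩ a b hab
    by_contra hcon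
    push Not at hcon
    have c1 := hcon _ h1
    have c2 := hcon _ h2
    have c3 := hcon _ h3
    push_cast at c1 c2 c3
    have p1' : (1 : ℝ) ≤ p.1 := by exact_mod_cast p1
    have p2' : (1 : ℝ) ≤ p.2 := by exact_mod_cast p2
    have p3' : (p.1 : ℝ) + p.2 ≤ w - 1 := by exact_mod_cast p3
    set s := a * (p.1 : ℝ) + b * p.2 with hs
    -- `p` is a combination of the three vertices with positive coefficients
    have id : ((w : ℝ) - p.1 - p.2) * s + p.1 * (s - a * w) + p.2 * (s - b * w) = 0 := by
      rw [hs]; ring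
    have n1 : 0 ≤ ((w : ℝ) - p.1 - p.2) * s := by
      apply mul_nonneg <;> linarith
    have n2 : 0 ≤ (p.1 : ℝ) * (s - a * w) := by
      apply mul_nonneg <;> linarith
    have n3 : 0 ≤ (p.2 : ℝ) * (s - b * w) := by
      apply mul_nonneg <;> linarith
    have hw' : (w : ℝ) ≠ 0 := by exact_mod_cast hw.ne'
    have z1 : s = 0 := by
      have : ((w : ℝ) - p.1 - p.2) * s = 0 := by linarith
      rcases mul_eq_zero.mp this with h4 | h4
      · linarith
      · exact h4
    have z2 : a = 0 := by
      have : (p.1 : ℝ) * (s - a * w) = 0 := by linarith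
      rcases mul_eq_zero.mp this with h4 | h4
      · linarith
      · rw [z1] at h4
        have : a * w = 0 := by linarith
        exact (mul_eq_zero.mp this).resolve_right hw'
    have z3 : b = 0 := by
      have : (p.2 : ℝ) * (s - b * w) = 0 := by linarith
      rcases mul_eq_zero.mp this with h4 | h4
      · linarith
      · rw [z1] at h4
        have : b * w = 0 := by linarith
        exact (mul_eq_zero.mp this).resolve_right hw'
    rcases hab with h | h
    · exact h z2
    · exact h z3

theorem ncard_triangle {w : ℤ} (hw : 5 ≤ w) :
    ({p | 1 ≤ p.1 ∧ 1 ≤ p.2 ∧ p.1 + p.2 ≤ w - 1} : Set (ℤ × ℤ)).ncard = 6 ∨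
    ({p | 1 ≤ p.1 ∧ 1 ≤ p.2 ∧ p.1 + p.2 ≤ w - 1} : Set (ℤ × ℤ)).ncard = 10 ∨
    13 ≤ ({p | 1 ≤ p.1 ∧ 1 ≤ p.2 ∧ p.1 + p.2 ≤ w - 1} : Set (ℤ × ℤ)).ncard := by
  have eq : ∀ w : ℤ, ({p | 1 ≤ p.1 ∧ 1 ≤ p.2 ∧ p.1 + p.2 ≤ w - 1} : Set (ℤ × ℤ)) =
      (((Finset.Icc 1 w ×ˢ Finset.Icc 1 w).filter fun p => p.1 + p.2 ≤ w - 1 :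
        Finset (ℤ × ℤ)) : Set (ℤ × ℤ)) := by
    intro w
    ext p
    simp only [Set.mem_ofPred_eq, Finset.coe_filter, Finset.mem_product, Finset.mem_Icc]
    omega
  rcases (show w = 5 ∨ w = 6 ∨ 7 ≤ w by omega) with rfl | rfl | h7
  · left
    rw [eq, Set.ncard_coe_finset]
    decide +kernel
  · right; left
    rw [eq, Set.ncard_coe_finset]
    decide +kernel
  · right; right
    have hsub : ({p | 1 ≤ p.1 ∧ 1 ≤ p.2 ∧ p.1 + p.2 ≤ 7 - 1} : Set (ℤ × ℤ)) ⊆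
        {p | 1 ≤ p.1 ∧ 1 ≤ p.2 ∧ p.1 + p.2 ≤ w - 1} := by
      intro p hp
      simp only [Set.mem_ofPred_eq] at hp ⊢
      omega
    refine le_trans ?_ (Set.ncard_le_ncard hsub (by rw [eq]; exact Finset.finite_toSet _))
    rw [eq, Set.ncard_coe_finset]
    decide +kernel

/-- If the lines of `Slab.exists_gap` converge upwards, the polygon is a dilated unimodular
triangle, which determines its number of interior lattice points. -/
theorem Slab.ncard_of_gap {V : Set (ℤ × ℤ)} {w : ℤ} (h : Slab V w) (hw5 : 5 ≤ w) {j m : ℤ}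
    (h0 : 0 < j) (hw : j < w) {σ τ : ℝ} (hστ : τ ≤ σ) (hV : ∀ v ∈ V,
      (m : ℝ) + σ * (v.2 - j) ≤ v.1 ∧ (v.1 : ℝ) ≤ m + 1 + τ * (v.2 - j)) :
    (IntPts V).ncard = 6 ∨ (IntPts V).ncard = 10 ∨ 13 ≤ (IntPts V).ncard := by
  obtain ⟨k, s, hks⟩ := h.subset_triangle (by omega) h0 hw hστ hV
  have hD : ((1 : ℤ) * 1 - k * 0) * (1 * 1 - k * 0) = 1 := by norm_num
  rw [← ncard_intPts_image_aff (s := s) (t := 0) hD]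
  have h' := h.shear k s
  set W := aff 1 k 0 1 s 0 '' V
  have hW : ∀ v ∈ W, 0 ≤ v.1 ∧ 0 ≤ v.2 ∧ v.1 + v.2 ≤ w := by
    intro v hv
    refine ⟨?_, h'.nonneg v hv, ?_⟩ <;> obtain ⟨u, hu, rfl⟩ := hv <;> have := hks u hu <;>
      simp only [aff] <;> linarith
  have c3 : ((0, w) : ℤ × ℤ) ∈ W := by
    obtain ⟨v, hv, hv0⟩ := h'.exists_top
    have := hW v hv
    have e : v = (0, w) := by ext <;> simp only <;> omega
    rwa [e] at hv
  have c2 : ((w, 0) : ℤ × ℤ) ∈ W := by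
    obtain ⟨u, hu, v, hv, huv⟩ := h'.wide 1 0 (by norm_num)
    have h1 := hW u hu
    have h2 := hW v hv
    have e : u = (w, 0) := by ext <;> simp only <;> omega
    rwa [e] at hu
  have c1 : ((0, 0) : ℤ × ℤ) ∈ W := by
    obtain ⟨u, hu, v, hv, huv⟩ := h'.wide 1 1 (by norm_num)
    have h1 := hW u hu
    have h2 := hW v hv
    have e : v = (0, 0) := by ext <;> simp only <;> omega
    rwa [e] at hv
  rw [intPts_triangle (by omega) hW c1 c2 c3]
  exact ncard_triangle hw5

/-- Every inner row of a polygon in minimal position contains an interior lattice point, unless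
the polygon is a dilated unimodular triangle, which the number of interior lattice points rules
out. -/
theorem Slab.exists_mem_row {V : Set (ℤ × ℤ)} {w : ℤ} (h : Slab V w) (hfin : V.Finite)
    (hw5 : 5 ≤ w) (h7 : 7 ≤ (IntPts V).ncard) (h12 : (IntPts V).ncard ≤ 12)
    (h10 : (IntPts V).ncard ≠ 10) {j : ℤ} (h0 : 0 < j) (hw : j < w) :
    ∃ x, (x, j) ∈ IntPts V := by
  by_contra hcon
  push Not at hcon
  obtain ⟨m, σ, τ, hV⟩ := h.exists_gap hfin h0 hw hcon
  rcases le_total τ σ with hστ | hστ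
  · have := h.ncard_of_gap hw5 h0 hw hστ hV
    omega
  · have := h.rotate.ncard_of_gap (j := w - j) (m := -m - 1) (σ := τ) (τ := σ) hw5 (by omega)
      (by omega) hστ (by
        rintro _ ⟨v, hv, rfl⟩
        have := hV v hv
        simp only [aff]
        push_cast
        constructor <;> linarith)
    rw [ncard_intPts_image_aff (by norm_num)] at this
    omega

/-! ### The rows of interior lattice points -/

/-- If a point strictly between `p` and the interior point `q` lies weakly to the left of a lattice
point `z`, and an interior lattice point `l` lies weakly to the right of `z` in the same row, then
`z` is interior. For `ε = -1` left and right are exchanged. -/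
theorem mem_intPts_of_between {V : Set (ℤ × ℤ)} {p q l z : ℤ × ℤ} {α β ε : ℤ}
    (hε : ε = 1 ∨ ε = -1) (hp : p ∈ V ∨ p ∈ IntPts V) (hq : q ∈ IntPts V) (hl : l ∈ IntPts V)
    (hlz : l.2 = z.2) (hzl : ε * z.1 ≤ ε * l.1) (hα : 0 ≤ α) (hβ : 0 < β)
    (h2 : α * p.2 + β * q.2 = (α + β) * z.2)
    (h1 : ε * (α * p.1 + β * q.1) ≤ ε * ((α + β) * z.1)) : z ∈ IntPts V := by
  intro a b hab
  by_contra hcon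
  push Not at hcon
  have hint : ∀ x ∈ IntPts V, a * x.1 + b * x.2 < a * z.1 + b * z.2 := by
    intro x hx
    obtain ⟨v, hv, hlt⟩ := hx a b hab
    exact hlt.trans_le (hcon v hv)
  have hfp : a * p.1 + b * p.2 ≤ a * z.1 + b * z.2 := by
    rcases hp with hp | hp
    · exact hcon p hp
    · exact (hint p hp).le
  have hfq := hint q hq
  have hfl := hint l hl
  rw [hlz] at hfl
  have hα' : (0 : ℝ) ≤ α := by exact_mod_cast hα
  have hβ' : (0 : ℝ) < β := by exact_mod_cast hβ
  have h2' : (α : ℝ) * p.2 + β * q.2 = (α + β) * z.2 := by exact_mod_cast h2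
  have h1' : (ε : ℝ) * (α * p.1 + β * q.1) ≤ ε * ((α + β) * z.1) := by exact_mod_cast h1
  have hzl' : (ε : ℝ) * z.1 ≤ ε * l.1 := by exact_mod_cast hzl
  have key : a * (α * p.1 + β * q.1) < a * ((α + β) * z.1) := by
    have s1 := mul_le_mul_of_nonneg_left hfp hα'
    have s2 := mul_lt_mul_of_pos_left hfq hβ'
    have s3 : b * ((α : ℝ) * p.2 + β * q.2) = b * ((α + β) * z.2) := by rw [h2']
    linarith
  rcases hε with rfl | rfl
  · push_cast at h1' hzl'
    have ha : a < 0 := by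
      by_contra ha
      push Not at ha
      have := mul_le_mul_of_nonneg_left hzl' ha
      linarith
    have := mul_le_mul_of_nonpos_left h1' ha.le
    linarith
  · push_cast at h1' hzl'
    have ha : 0 < a := by
      by_contra ha
      push Not at ha
      have := mul_le_mul_of_nonpos_left hzl' ha
      linarith
    have := mul_le_mul_of_nonneg_left h1' ha.le
    linarith

/-- The interior lattice points in row `y` reach from `(l y, y)` to `(r y, y)`. -/
structure Rows (V : Set (ℤ × ℤ)) (w : ℕ) (l r : ℕ → ℤ) : Prop where
  left_mem : ∀ y : ℕ, 0 < y → y < w → (l y, (y : ℤ)) ∈ IntPts V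
  right_mem : ∀ y : ℕ, 0 < y → y < w → (r y, (y : ℤ)) ∈ IntPts V
  left_le : ∀ y : ℕ, 0 < y → y < w → ∀ x, (x, (y : ℤ)) ∈ IntPts V → l y ≤ x
  le_right : ∀ y : ℕ, 0 < y → y < w → ∀ x, (x, (y : ℤ)) ∈ IntPts V → x ≤ r y

theorem exists_rows {V : Set (ℤ × ℤ)} {w : ℕ} (hfin : (IntPts V).Finite)
    (h : ∀ y : ℕ, 0 < y → y < w → ∃ x, (x, (y : ℤ)) ∈ IntPts V) : ∃ l r, Rows V w l r := by
  have key : ∀ y : ℕ, ∃ l r : ℤ, 0 < y → y < w → (l, (y : ℤ)) ∈ IntPts V ∧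
      (r, (y : ℤ)) ∈ IntPts V ∧ ∀ x, (x, (y : ℤ)) ∈ IntPts V → l ≤ x ∧ x ≤ r := by
    intro y
    by_cases hy : 0 < y ∧ y < w
    · have hf : {x : ℤ | (x, (y : ℤ)) ∈ IntPts V}.Finite :=
        hfin.preimage (f := fun x : ℤ => (x, (y : ℤ))) fun a _ b _ hab => (Prod.mk.inj hab).1
      have hne : {x : ℤ | (x, (y : ℤ)) ∈ IntPts V}.Nonempty := h y hy.1 hy.2
      obtain ⟨l, hl, hl'⟩ := Set.exists_min_image _ id hf hne
      obtain ⟨r, hr, hr'⟩ := Set.exists_max_image _ id hf hne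
      exact ⟨l, r, fun _ _ => ⟨hl, hr, fun x hx => ⟨hl' x hx, hr' x hx⟩⟩⟩
    · exact ⟨0, 0, fun h1 h2 => absurd ⟨h1, h2⟩ hy⟩
  choose l r hlr using key
  exact ⟨l, r, fun y h1 h2 => (hlr y h1 h2).1, fun y h1 h2 => (hlr y h1 h2).2.1,
    fun y h1 h2 x hx => ((hlr y h1 h2).2.2 x hx).1, fun y h1 h2 x hx => ((hlr y h1 h2).2.2 x hx).2⟩

theorem Rows.shear {V : Set (ℤ × ℤ)} {w : ℕ} {l r : ℕ → ℤ} (h : Rows V w l r) (k s : ℤ) :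
    Rows (aff 1 k 0 1 s 0 '' V) w (fun y => l y + k * y + s) (fun y => r y + k * y + s) := by
  have key : ∀ x y : ℤ, (x + k * y + s, y) ∈ IntPts (aff 1 k 0 1 s 0 '' V) ↔
      (x, y) ∈ IntPts V := by
    intro x y
    rw [← aff_mem_intPts (e := 1) (f := k) (a := 0) (b := 1) (s := s) (t := 0) (by norm_num)
      (x, y)]
    simp [aff]
  have key' : ∀ x y : ℤ, (x, y) ∈ IntPts (aff 1 k 0 1 s 0 '' V) →
      (x - k * y - s, y) ∈ IntPts V := by
    intro x y hx
    rw [← key]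
    convert hx using 2
    ring
  refine ⟨fun y h1 h2 => (key _ _).mpr (h.left_mem y h1 h2),
    fun y h1 h2 => (key _ _).mpr (h.right_mem y h1 h2), fun y h1 h2 x hx => ?_,
    fun y h1 h2 x hx => ?_⟩
  · have := h.left_le y h1 h2 _ (key' x y hx)
    linarith
  · have := h.le_right y h1 h2 _ (key' x y hx)
    linarith

/-- The extreme interior lattice points of the rows on one side of the polygon satisfy the
constraints of `Side`. -/
theorem side_of_extreme {V : Set (ℤ × ℤ)} {w : ℕ} {m : ℕ → ℤ} {c ε : ℤ} (hε : ε = 1 ∨ ε = -1)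
    (hm : ∀ y : ℕ, 0 < y → y < w → (m y, (y : ℤ)) ∈ IntPts V)
    (hle : ∀ y : ℕ, 0 < y → y < w → ∀ x, (x, (y : ℤ)) ∈ IntPts V → ε * m y ≤ ε * x) :
    Side V w (fun v => c + ε * v.1) (fun y => c + ε * m y) := by
  have hεε : ε * ε = 1 := by rcases hε with rfl | rfl <;> norm_num
  have hnot : ∀ y : ℕ, 0 < y → y < w → (m y - ε, (y : ℤ)) ∉ IntPts V := by
    intro y h1 h2 hmem
    have := hle y h1 h2 _ hmem
    linarith
  have hull : ∀ p : ℤ × ℤ, p ∈ V ∨ p ∈ IntPts V → ∀ y : ℕ, p.2 = y →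
      Supports (fun y => c + ε * m y) w y (c + ε * p.1) := by
    intro p hp y hy
    constructor
    · intro i k hyi hik hkw
      by_contra hcon
      push Not at hcon
      refine hnot i (by omega) (by omega) (mem_intPts_of_between (α := k - i) (β := i - y)
        (l := (m i, i)) hε hp (hm k (by omega) hkw) (hm i (by omega) (by omega)) rfl ?_
        (by omega) (by omega) ?_ ?_)
      · simp only
        linarith
      · simp only [hy]
        ring
      · simp only
        linear_combination hcon + ((k : ℤ) - y) * hεε
    · intro i k hk hki hiy hiw
      by_contra hcon
      push Not at hcon
      refine hnot i (by omega) (by omega) (mem_intPts_of_between (α := i - k) (β := y - i)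
        (l := (m i, i)) hε hp (hm k (by omega) (by omega)) (hm i (by omega) (by omega)) rfl ?_
        (by omega) (by omega) ?_ ?_)
      · simp only
        linarith
      · simp only [hy]
        ring
      · simp only
        linear_combination hcon + ((y : ℤ) - k) * hεε
  refine ⟨fun y h1 h2 => hull _ (Or.inr (hm y h1 h2)) y rfl, fun v hv y hy => hull v (Or.inl hv) y hy,
    fun v hv y hy h1 h2 => ?_⟩
  by_contra hcon
  push Not at hcon
  have hv1 : 0 < ε * (m y - v.1) - 1 := by linarith
  refine hnot y h1 h2 (mem_intPts_of_between (p := v) (α := 1) (β := ε * (m y - v.1) - 1)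
    (l := (m y, y)) hε (Or.inl hv) (hm y h1 h2) (hm y h1 h2) rfl ?_ (by norm_num) hv1 ?_ ?_)
  · simp only
    linarith
  · simp only [hy]
    ring
  · simp only
    linear_combination (m y - v.1) * ε * hεε

theorem Rows.mem_of_le {V : Set (ℤ × ℤ)} {w : ℕ} {l r : ℕ → ℤ} (h : Rows V w l r) {y : ℕ}
    (h1 : 0 < y) (h2 : y < w) {x : ℤ} (hl : l y ≤ x) (hr : x ≤ r y) :
    (x, (y : ℤ)) ∈ IntPts V := by
  rcases hl.eq_or_lt with rfl | hl
  · exact h.left_mem y h1 h2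
  · apply mem_intPts_of_between (p := (l y, (y : ℤ))) (q := (r y, (y : ℤ))) (l := (r y, (y : ℤ)))
      (z := (x, (y : ℤ))) (α := r y - x) (β := x - l y) (ε := 1) (Or.inl rfl) (Or.inr (h.left_mem y h1 h2))
      (h.right_mem y h1 h2) (h.right_mem y h1 h2) rfl
    · simpa using hr
    · omega
    · omega
    · simp only
      ring
    · simp only
      linarith

theorem Rows.countUpTo_eq {V : Set (ℤ × ℤ)} {w : ℕ} {l r : ℕ → ℤ} (h : Rows V w l r)
    (hV : Slab V w) (C : ℕ) :
    countUpTo C l (fun y => C - r y) (w - 1) = (IntPts V).ncard := by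
  have hset : IntPts V = ((Finset.Icc 1 (w - 1)).biUnion fun y : ℕ =>
      (Finset.Icc (l y) (r y)).image fun x => (x, (y : ℤ)) : Finset (ℤ × ℤ)) := by
    ext p
    simp only [Finset.coe_biUnion, Finset.mem_coe, Finset.mem_Icc, Finset.coe_image, Set.mem_iUnion,
      Set.mem_image, exists_prop]
    constructor
    · intro hp
      have hrow := hV.row_mem hp
      obtain ⟨y, hy⟩ : ∃ y : ℕ, (y : ℤ) = p.2 := ⟨p.2.toNat, by omega⟩
      have hp' : (p.1, (y : ℤ)) ∈ IntPts V := by rw [hy]; exact hp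
      exact ⟨y, by omega, p.1, ⟨h.left_le y (by omega) (by omega) _ hp',
        h.le_right y (by omega) (by omega) _ hp'⟩, by rw [hy]⟩
    · rintro ⟨y, hy, x, hx, rfl⟩
      exact h.mem_of_le (by omega) (by omega) hx.1 hx.2
  rw [hset, Set.ncard_coe_finset, Finset.card_biUnion]
  · push_cast
    apply Finset.sum_congr rfl
    intro y hy
    rw [Finset.mem_Icc] at hy
    rw [Finset.card_image_of_injective _ fun a b hab => (Prod.mk.inj hab).1, Int.card_Icc]
    have := h.left_le y (by omega) (by omega) _ (h.right_mem y (by omega) (by omega))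
    rw [Int.toNat_of_nonneg (by omega)]
    ring
  · intro y _ y' _ hyy'
    rw [Function.onFun, Finset.disjoint_left]
    rintro p hp hp'
    simp only [Finset.mem_image] at hp hp'
    obtain ⟨x, _, rfl⟩ := hp
    obtain ⟨x', _, hx'⟩ := hp'
    have := (Prod.mk.inj hx').2
    omega

/-- In minimal position, no width `w ≥ g / 2 + 1` is possible for the numbers `g` of interior lattice
points in question. A shear moves the leftmost points of rows `1` and `2` to abscissa `100`, where
the search starts. -/
theorem Slab.contradiction {V : Set (ℤ × ℤ)} {w : ℕ} (hV : Slab V w) (hfin : V.Finite)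
    (hw : 5 ≤ w) (h7 : 7 ≤ (IntPts V).ncard) (h12 : (IntPts V).ncard ≤ 12)
    (h10 : (IntPts V).ncard ≠ 10) (hgw : (IntPts V).ncard + 2 ≤ 2 * w) : False := by
  obtain ⟨l, r, hlr⟩ := exists_rows (V := V) (w := w) (Set.finite_of_ncard_pos (by omega))
    fun y h1 h2 => hV.exists_mem_row hfin (by omega) h7 h12 h10 (by omega) (by omega)
  set k := l 1 - l 2 with hk
  set s := 100 - l 1 - k with hs
  have hS := hV.shear k s
  have hR := hlr.shear k s
  rw [← ncard_intPts_image_aff (e := 1) (f := k) (a := 0) (b := 1) (s := s) (t := 0)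
    (by norm_num)] at h7 h12 h10 hgw
  have hleft := side_of_extreme (c := 0) (ε := 1) (Or.inl rfl) hR.left_mem
    fun y h1 h2 x hx => by simpa using hR.left_le y h1 h2 x hx
  have hright := side_of_extreme (c := 200) (ε := -1) (Or.inr rfl) hR.right_mem
    fun y h1 h2 x hx => by
      have := hR.le_right y h1 h2 x hx
      linarith
  simp only [zero_add, one_mul, neg_one_mul, ← sub_eq_add_neg] at hleft hright
  refine Profile.contradiction (V := aff 1 k 0 1 s 0 '' V) (w := w) ⟨hS, hleft, ?_, ?_⟩ hw
    (hR.countUpTo_eq hS 200) h7 h12 h10 hgw ?_ ?_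
  · exact_mod_cast hright
  · intro y h1 h2
    have := hR.left_le y h1 h2 _ (hR.right_mem y h1 h2)
    push_cast
    linarith
  · push_cast
    linarith
  · push_cast
    linarith

/-! ### Minimal position -/

/-- A set of lattice points can be moved by a unimodular map so that its minimal width is attained
by the second coordinate. -/
theorem exists_slab {V : Set (ℤ × ℤ)} (hfin : V.Finite) {B : ℤ} (hB : 0 < B)
    (hwide : ∀ a b : ℤ, a ≠ 0 ∨ b ≠ 0 → ∃ u ∈ V, ∃ v ∈ V, B ≤ a * (u.1 - v.1) + b * (u.2 - v.2)) :
    ∃ (w : ℕ) (W : Set (ℤ × ℤ)), B ≤ w ∧ W.Finite ∧ Slab W w ∧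
      (IntPts W).ncard = (IntPts V).ncard := by
  classical
  have hex : ∃ n : ℕ, ∃ a b : ℤ, (a ≠ 0 ∨ b ≠ 0) ∧
      ∀ u ∈ V, ∀ v ∈ V, a * (u.1 - v.1) + b * (u.2 - v.2) ≤ n := by
    obtain ⟨m, hm⟩ := (hfin.image Prod.fst).bddBelow
    obtain ⟨M, hM⟩ := (hfin.image Prod.fst).bddAbove
    refine ⟨(M - m).toNat, 1, 0, by norm_num, fun u hu v hv => ?_⟩
    have h1 := hM (Set.mem_image_of_mem _ hu)
    have h2 := hm (Set.mem_image_of_mem _ hv)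
    omega
  set w := Nat.find hex with hw
  obtain ⟨a, b, hab, hle⟩ := Nat.find_spec hex
  rw [← hw] at hle
  have hBw : B ≤ w := by
    obtain ⟨u, hu, v, hv, huv⟩ := hwide a b hab
    exact huv.trans (hle u hu v hv)
  have hmin : ∀ α β : ℤ, α ≠ 0 ∨ β ≠ 0 →
      ∃ u ∈ V, ∃ v ∈ V, (w : ℤ) ≤ α * (u.1 - v.1) + β * (u.2 - v.2) := by
    intro α β hαβ
    by_contra hcon
    push Not at hcon
    refine Nat.find_min hex (m := w - 1) (by omega) ⟨α, β, hαβ, fun u hu v hv => ?_⟩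
    have := hcon u hu v hv
    omega
  -- a functional of minimal width is primitive
  obtain ⟨e, f, hef⟩ : ∃ e f : ℤ, e * b - f * a = 1 := by
    have hg : Int.gcd a b = 1 := by
      have hg0 : 0 < Int.gcd a b := Int.gcd_pos_iff.mpr hab
      obtain ⟨a', ha'⟩ := Int.gcd_dvd_left a b
      obtain ⟨b', hb'⟩ := Int.gcd_dvd_right a b
      set d := Int.gcd a b
      have hab' : a' ≠ 0 ∨ b' ≠ 0 := by
        by_contra hcon
        push Not at hcon
        rw [hcon.1, mul_zero] at ha'
        rw [hcon.2, mul_zero] at hb'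
        tauto
      obtain ⟨u, hu, v, hv, huv⟩ := hmin a' b' hab'
      have h1 := hle u hu v hv
      have h2 : a * (u.1 - v.1) + b * (u.2 - v.2) =
          d * (a' * (u.1 - v.1) + b' * (u.2 - v.2)) := by
        rw [ha', hb']; ring
      rw [h2] at h1
      have h3 : (d : ℤ) * w ≤ d * (a' * (u.1 - v.1) + b' * (u.2 - v.2)) :=
        mul_le_mul_of_nonneg_left huv (by omega)
      by_contra hd1
      have h4 : (2 : ℤ) * w ≤ d * w := mul_le_mul_of_nonneg_right (by omega) (by omega)
      omega
    have := Int.gcd_eq_gcd_ab a b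
    rw [hg] at this
    push_cast at this
    exact ⟨Int.gcdB a b, -Int.gcdA a b, by linarith⟩
  obtain ⟨u, hu, v, hv, huv⟩ := hmin a b hab
  have hD : (e * b - f * a) * (e * b - f * a) = 1 := by rw [hef, one_mul]
  refine ⟨w, aff e f a b 0 (-(a * v.1 + b * v.2)) '' V, hBw, hfin.image _, ⟨?_, ?_, ?_, ?_, ?_⟩,
    ncard_intPts_image_aff hD⟩
  · rintro _ ⟨z, hz, rfl⟩
    have := hle u hu z hz
    simp only [aff]
    linarith
  · rintro _ ⟨z, hz, rfl⟩
    have := hle z hz v hv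
    simp only [aff]
    linarith
  · exact ⟨_, ⟨v, hv, rfl⟩, by simp only [aff]; ring⟩
  · refine ⟨_, ⟨u, hu, rfl⟩, ?_⟩
    have := hle u hu v hv
    simp only [aff]
    linarith
  · exact wide_image_aff hD hmin

/-! ### Convex hulls -/

theorem le_of_mem_convexHull {V : Set (ℤ × ℤ)} {a b c : ℝ}
    (h : ∀ v ∈ V, a * v.1 + b * v.2 ≤ c) {x : ℝ × ℝ} (hx : x ∈ convexHull ℝ (toPlane '' V)) :
    a * x.1 + b * x.2 ≤ c := by
  have hconv : Convex ℝ {x : ℝ × ℝ | a * x.1 + b * x.2 ≤ c} := by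
    apply convex_halfSpace_le
    refine ⟨fun x y => ?_, fun k x => ?_⟩
    · simp only [Prod.fst_add, Prod.snd_add]; ring
    · simp only [Prod.smul_fst, Prod.smul_snd, smul_eq_mul]; ring
  refine convexHull_min ?_ hconv hx
  rintro _ ⟨v, hv, rfl⟩
  exact h v hv

theorem apply_eq_fst_snd (f : ℝ × ℝ →ₗ[ℝ] ℝ) (x : ℝ × ℝ) :
    f x = f (1, 0) * x.1 + f (0, 1) * x.2 := by
  have : x = x.1 • ((1, 0) : ℝ × ℝ) + x.2 • ((0, 1) : ℝ × ℝ) := by ext <;> simp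
  conv_lhs => rw [this]
  rw [map_add, map_smul, map_smul, smul_eq_mul, smul_eq_mul]
  ring

/-- Outside the interior of a convex set there is a nonzero functional, given by its coefficients,
that is nowhere larger on the set than at the point. -/
theorem exists_functional_of_notMem_interior {K : Set (ℝ × ℝ)} (hK : Convex ℝ K)
    {p : ℝ × ℝ} (hp : p ∉ interior K) : ∃ a b : ℝ, (a ≠ 0 ∨ b ≠ 0) ∧
      ∀ x ∈ K, a * x.1 + b * x.2 ≤ a * p.1 + b * p.2 := by
  have coeff : ∀ f : ℝ × ℝ →ₗ[ℝ] ℝ, f ≠ 0 → f (1, 0) ≠ 0 ∨ f (0, 1) ≠ 0 := by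
    intro f hf
    by_contra hcon
    push Not at hcon
    apply hf
    ext <;> simp [hcon.1, hcon.2]
  by_cases hne : (interior K).Nonempty
  · obtain ⟨f, hf⟩ := geometric_hahn_banach_open_point hK.interior isOpen_interior hp
    obtain ⟨q, hq⟩ := hne
    refine ⟨f (1, 0), f (0, 1), coeff f.toLinearMap ?_, fun x hx => ?_⟩
    · intro h0
      have h1 := hf q hq
      have h2 : ∀ y, f y = 0 := fun y => by
        simpa using LinearMap.congr_fun h0 y
      rw [h2, h2] at h1
      exact lt_irrefl _ h1
    · have hcl : x ∈ closure (interior K) := by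
        rw [hK.closure_interior_eq_closure_of_nonempty_interior ⟨q, hq⟩]
        exact subset_closure hx
      have hsub : closure (interior K) ⊆ {y | f y ≤ f p} :=
        closure_minimal (fun y hy => (hf y hy).le) (isClosed_le f.continuous continuous_const)
      have h1 : f x ≤ f p := hsub hcl
      have h2 := apply_eq_fst_snd f.toLinearMap x
      have h3 := apply_eq_fst_snd f.toLinearMap p
      simp only [ContinuousLinearMap.coe_coe] at h2 h3
      linarith
  · rcases K.eq_empty_or_nonempty with rfl | ⟨q, hq⟩
    · exact ⟨1, 0, by norm_num, fun x hx => absurd hx (Set.notMem_empty x)⟩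
    have hspan : vectorSpan ℝ K < ⊤ := by
      rw [lt_top_iff_ne_top]
      intro htop
      apply hne
      rw [hK.interior_nonempty_iff_affineSpan_eq_top]
      exact (AffineSubspace.affineSpan_eq_top_iff_vectorSpan_eq_top_of_nonempty ℝ _ _ ⟨q, hq⟩).mpr
        htop
    obtain ⟨f, hf0, hf⟩ := Submodule.exists_le_ker_of_lt_top _ hspan
    have hconst : ∀ x ∈ K, f x = f q := by
      intro x hx
      have := hf (vsub_mem_vectorSpan ℝ hx hq)
      rw [LinearMap.mem_ker, vsub_eq_sub, map_sub] at this
      linarith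
    rcases le_total (f q) (f p) with h | h
    · refine ⟨f (1, 0), f (0, 1), coeff f hf0, fun x hx => ?_⟩
      rw [← apply_eq_fst_snd, ← apply_eq_fst_snd, hconst x hx]
      exact h
    · refine ⟨-f (1, 0), -f (0, 1), ?_, fun x hx => ?_⟩
      · simpa using coeff f hf0
      · have h1 := hconst x hx
        rw [apply_eq_fst_snd f x] at h1
        rw [apply_eq_fst_snd f p] at h
        linarith

theorem interiorLatticePoints_convexHull (V : Set (ℤ × ℤ)) :
    interiorLatticePoints (convexHull ℝ (toPlane '' V)) = IntPts V := by
  ext p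
  constructor
  · intro hp a b hab
    by_contra hcon
    push Not at hcon
    -- the half-plane containing the convex hull has `p` on its boundary
    have hnhds : convexHull ℝ (toPlane '' V) ∈ nhds (toPlane p) := mem_interior_iff_mem_nhds.mp hp
    have hcont : Filter.Tendsto (fun ε : ℝ => toPlane p + ε • ((a, b) : ℝ × ℝ)) (nhds 0)
        (nhds (toPlane p)) := by
      have : Continuous fun ε : ℝ => toPlane p + ε • ((a, b) : ℝ × ℝ) := by fun_prop
      simpa using this.tendsto 0
    obtain ⟨ε, hε, hε0⟩ := ((hcont.eventually hnhds).filter_mono nhdsWithin_le_nhds |>.and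
      (self_mem_nhdsWithin (s := Set.Ioi (0 : ℝ)))).exists
    have h1 := le_of_mem_convexHull hcon hε
    simp only [toPlane, Prod.fst_add, Prod.snd_add, Prod.smul_fst, Prod.smul_snd,
      smul_eq_mul] at h1
    have h2 : 0 < a * a + b * b := by
      rcases hab with h | h
      · have := mul_self_pos.mpr h
        nlinarith [mul_self_nonneg b]
      · have := mul_self_pos.mpr h
        nlinarith [mul_self_nonneg a]
    have h3 : 0 < ε * (a * a + b * b) := mul_pos hε0 h2
    linarith
  · intro hp
    by_contra hcon
    obtain ⟨a, b, hab, h⟩ := exists_functional_of_notMem_interior (convex_convexHull ℝ _) hcon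
    obtain ⟨v, hv, hlt⟩ := hp a b hab
    have := h (toPlane v) (subset_convexHull ℝ _ (Set.mem_image_of_mem _ hv))
    simp only [toPlane] at this
    linarith

theorem latticeWidth_le {V : Set (ℤ × ℤ)} (hfin : V.Finite) (hne : V.Nonempty) {a b : ℤ}
    (hab : a ≠ 0 ∨ b ≠ 0) {B : ℤ}
    (h : ∀ u ∈ V, ∀ v ∈ V, a * (u.1 - v.1) + b * (u.2 - v.2) ≤ B) :
    latticeWidth (convexHull ℝ (toPlane '' V)) ≤ B := by
  set P := convexHull ℝ (toPlane '' V) with hP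
  have hPne : P.Nonempty := (hne.image _).convexHull
  have range : ∀ T : (ℤ × ℤ) →ₗ[ℤ] ℤ, ∃ u ∈ V, ∃ v ∈ V, ∀ x ∈ P,
      ((T (1, 0) * v.1 + T (0, 1) * v.2 : ℤ) : ℝ) ≤ realExtension T x ∧
      realExtension T x ≤ ((T (1, 0) * u.1 + T (0, 1) * u.2 : ℤ) : ℝ) := by
    intro T
    obtain ⟨u, hu, hu'⟩ :=
      Set.exists_max_image V (fun v => T (1, 0) * v.1 + T (0, 1) * v.2) hfin hne
    obtain ⟨v, hv, hv'⟩ :=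
      Set.exists_min_image V (fun v => T (1, 0) * v.1 + T (0, 1) * v.2) hfin hne
    refine ⟨u, hu, v, hv, fun x hx => ⟨?_, ?_⟩⟩
    · have := le_of_mem_convexHull (V := V) (a := -(T (1, 0) : ℝ)) (b := -(T (0, 1) : ℝ))
        (c := -((T (1, 0) * v.1 + T (0, 1) * v.2 : ℤ) : ℝ)) (fun z hz => by
          have h1 : ((T (1, 0) * v.1 + T (0, 1) * v.2 : ℤ) : ℝ) ≤
            ((T (1, 0) * z.1 + T (0, 1) * z.2 : ℤ) : ℝ) := by exact_mod_cast hv' z hz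
          push_cast at h1 ⊢
          linarith) hx
      simp only [realExtension]
      linarith
    · exact le_of_mem_convexHull (V := V) (fun z hz => by
        have h1 : ((T (1, 0) * z.1 + T (0, 1) * z.2 : ℤ) : ℝ) ≤
          ((T (1, 0) * u.1 + T (0, 1) * u.2 : ℤ) : ℝ) := by exact_mod_cast hu' z hz
        push_cast at h1 ⊢
        linarith) hx
  have hbdd : BddBelow {w : ℝ | ∃ T : (ℤ × ℤ) →ₗ[ℤ] ℤ, T ≠ 0 ∧ w = widthAlong P T} := by
    refine ⟨0, ?_⟩
    rintro _ ⟨T, -, rfl⟩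
    obtain ⟨u, -, v, -, hr⟩ := range T
    refine sub_nonneg.mpr (Real.sInf_le_sSup _
      ⟨((T (1, 0) * v.1 + T (0, 1) * v.2 : ℤ) : ℝ), ?_⟩
      ⟨((T (1, 0) * u.1 + T (0, 1) * u.2 : ℤ) : ℝ), ?_⟩)
    · rintro _ ⟨x, hx, rfl⟩
      exact (hr x hx).1
    · rintro _ ⟨x, hx, rfl⟩
      exact (hr x hx).2
  let T : (ℤ × ℤ) →ₗ[ℤ] ℤ := a • LinearMap.fst ℤ ℤ ℤ + b • LinearMap.snd ℤ ℤ ℤ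
  have hTa : T (1, 0) = a := by simp [T]
  have hTb : T (0, 1) = b := by simp [T]
  have hT0 : T ≠ 0 := by
    intro h0
    rw [h0] at hTa hTb
    simp only [LinearMap.zero_apply] at hTa hTb
    rcases hab with h | h
    · exact h hTa.symm
    · exact h hTb.symm
  refine (csInf_le hbdd ⟨T, hT0, rfl⟩).trans ?_
  obtain ⟨u, hu, v, hv, hr⟩ := range T
  have h1 : sSup (realExtension T '' P) ≤ ((T (1, 0) * u.1 + T (0, 1) * u.2 : ℤ) : ℝ) := by
    apply csSup_le (hPne.image _)
    rintro _ ⟨x, hx, rfl⟩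
    exact (hr x hx).2
  have h2 : ((T (1, 0) * v.1 + T (0, 1) * v.2 : ℤ) : ℝ) ≤ sInf (realExtension T '' P) := by
    apply le_csInf (hPne.image _)
    rintro _ ⟨x, hx, rfl⟩
    exact (hr x hx).1
  have h3 : ((T (1, 0) * u.1 + T (0, 1) * u.2 : ℤ) : ℝ) -
      ((T (1, 0) * v.1 + T (0, 1) * v.2 : ℤ) : ℝ) ≤ B := by
    have := h u hu v hv
    rw [hTa, hTb]
    exact_mod_cast (by linarith : a * u.1 + b * u.2 - (a * v.1 + b * v.2) ≤ B)
  rw [widthAlong]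
  linarith

end LatticePolygon

theorem proposition3p4 (P : Set (ℝ × ℝ)) (hP : LatticePolygon.IsConvexLatticePolygon P)
    (g : ℕ) (hg : (LatticePolygon.interiorLatticePoints P).ncard = g)
    (hg7 : 7 ≤ g) (hg12 : g ≤ 12) (hg10 : g ≠ 10) :
    LatticePolygon.latticeWidth P ≤ ((⌈(g : ℝ) / 2⌉ : ℤ) : ℝ) := by
  obtain ⟨V, hV, rfl⟩ := hP
  rw [LatticePolygon.interiorLatticePoints_convexHull] at hg
  by_contra hcon
  set B : ℤ := ⌈(g : ℝ) / 2⌉ with hB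
  have hgB : (g : ℤ) ≤ 2 * B := by
    have : (g : ℝ) / 2 ≤ B := Int.le_ceil _
    have : (g : ℝ) ≤ 2 * B := by linarith
    exact_mod_cast this
  obtain ⟨w, W, hBw, hW, hslab, hcard⟩ := LatticePolygon.exists_slab (V := (V : Set (ℤ × ℤ)))
    V.finite_toSet (B := B + 1) (by omega) fun a b hab => by
      by_contra hlt
      push Not at hlt
      exact hcon (LatticePolygon.latticeWidth_le V.finite_toSet hV hab fun u hu v hv => by
        have := hlt u hu v hv
        omega)
  rw [hg] at hcard
  subst hcard
  exact hslab.contradiction hW (by omega) hg7 hg12 hg10 (by omega)
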